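/- **Setting.** Let $(V,E)$ be a finite directed graph whose arcs $e$ have transit times $\tau_e>0$ and capacities $\nu_e>0$; $\delta^+_v,\delta^-_v$ are the sets of arcs leaving and entering $v$. Let $J$ be a finite set of commodities. Each $j\in J$ has a simple $o_j$-$d_j$-path $P_j$ with at least one arc and an integrable, bounded supply rate $u_j:[0,\infty)\to[0,\infty)$ with bounded support; put $m_j=\int_0^\infty u_j$ and $M_j=[0,m_j]$. **Flow over time.** Let $f=(f^+_{j,e},f^-_{j,e})$ be a feasible flow over time in which every commodity $j$ uses only the arcs of $P_j$. That is, the $f^\pm_{j,e}$ are nonnegative, bounded, locally integrable and vanish on $(-\infty,0)$ and, with $F^\pm_{j,e}(\theta)=\int_0^\theta f^\pm_{j,e}$, $f^\pm_e=\sum_j f^\pm_{j,e}$, $F^\pm_e=\sum_jF^\pm_{j,e}$, $z_e(\theta)=F^+_e(\theta-\tau_e)-F^-_e(\theta)$ and $T_e(\theta)=\theta+\tau_e+z_e(\theta+\tau_e)/\nu_e$, the following holds for almost all $\theta\ge 0$: * $\sum_{e\in\delta^+_v}f^+_{j,e}(\theta)-\sum_{e\in\delta^-_v}f^-_{j,e}(\theta)$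 is $0$ for $v\ne o_j,d_j$, is $u_j(\theta)$ for $v=o_j$, and is $\le 0$ for $v=d_j$; * $f^-_e(\theta)=\nu_e$ if $z_e(\theta)>0$, and $f_e^-(\theta)=\min\{f^+_e(\theta-\tau_e),\nu_e\}$ otherwise (so that $z_e\ge 0$); * with $\vartheta=\min\{\xi\le\theta: T_e(\xi)=\theta\}$, $f^-_{j,e}(\theta)=f^-_e(\theta)\,f^+_{j,e}(\vartheta)/f^+_e(\vartheta)$ if $f^+_e(\vartheta)>0$, and $f^-_{j,e}(\theta)=0$ otherwise. For $\phi\in M_j$ let $\ell_{j,o_j}(\phi)=\min\{\theta\ge0:\int_0^\theta u_j=\phi\}$ and $\ell_{j,v}(\phi)=T_e(\ell_{j,u}(\phi))$ for each arc $e=uv$ of $P_j$. **Packet routing.** For a time step length $\alpha>0$ and a packet size $\beta>0$, commodity $j$ consists of the packets $N_j=\{1,\dots,\lfloor m_j/\beta\rfloor\}$, which all take the path $P_j$; packet $i$ is released at $o_j$ in the first time step $t\in\mathbb N_0$ with $\int_0^{\alpha t}u_j\ge i\beta$. Each arc $e$ carries a first-in-first-out line of packets, empty at $t=0$, and has a current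 capacity, initially $\hat\nu_e(0)=\hat\nu_e:=\nu_e\alpha/\beta$. In time step $t$: * the buffer $B_e(t)$ consists of the packets of the line that entered $e$ in time step $t-\lceil\tau_e/\alpha\rceil$ or earlier, and $L^-_e(t)$ consists of the first $\lfloor\hat\nu_e(t)\rfloor$ packets of the buffer (all, if there are fewer); these leave $e$; * the list $L^+_e(t)$ of the packets entering $e=vw$ consists of all packets leaving an arc $e'$ on whose path $e$ directly follows $e'$, and of all packets released at $v$ in time step $t$ whose path starts with $e$ (ordered by an arbitrary numbering of all packets that is increasing in $i$ within each commodity). These groups are merged as follows: a nonempty group $Y$ of $y$ packets starts with counter $1/y$; repeatedly, the first remaining packet of a nonempty group with smallest counter is appended to $L^+_e(t)$, and the counter of this group grows by $1/y$. Ties are broken arbitrarily; * $L^-_e(t)$ is removed from the front of the line, $L^+_e(t)$ is appended at its end, and $\hat\nu_e(t+1)$ is $\hat\nu_e$ if $|B_e(t)|\le\hat\nu_e(t)$, and $\hat\nu_e+\hat\nu_e(t)-\lfloor\hat\nu_e(t)\rfloor$ otherwise. For $\theta\ge 0$ let $g^\pm_{j,e}(\theta)$ be $\beta/\alpha$ times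 the number of packets of commodity $j$ in $L^\pm_e(\lceil\theta/\alpha\rceil)$, and let $G^\pm_{j,e}(\theta)=\int_0^\theta g^\pm_{j,e}$. The arrival time $\ell^D_{j,v}(i)$ of packet $i\in N_j$ at a node $v$ of $P_j$ is $\min\{\theta\ge0: G(\theta)\ge i\beta\}$, where $G=G^+_{j,e}$ for the arc $e$ of $P_j$ that leaves $v$ or, if $v=d_j$, $G=G^-_{j,e}$ for the last arc $e$ of $P_j$. **Theorem.** Consider the packet routings induced by a sequence of parameters $(\alpha,\beta)$ with $\alpha\to0$ and $\beta/\alpha\to0$. Then: 1. For every $j\in J$ and every node $v$ of $P_j$, the arrival times $\ell^D_{j,v}(i)$ of all packets $i\in N_j$ are well defined (the minimum exists) for all but finitely many members of the sequence. For every $\phi\in M_j$ at which $\ell_{j,v}:M_j\to\mathbb R$ is continuous, $\ell^D_{j,v}(\lceil\phi/\beta\rceil)$ converges to $\ell_{j,v}(\phi)$ along those members of the sequence for which $\lceil\phi/\beta\rceil\in N_j$ (for $0<\phi<m_j$, these are all but finitely many). At a particle $\phi$ at which $\ell_{j,v}$ is discontinuous, the same holds along those members for which, in addition, $\phi$ is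 an integer multiple of $\beta$. 2. For every $j\in J$ and every arc $e$ of $P_j$, $G^+_{j,e}$ converges to $F^+_{j,e}$ and $G^-_{j,e}$ converges to $F^-_{j,e}$, uniformly on $[0,\infty)$. -/

import Mathlib

open Filter Topology MeasureTheory

/-- A network: a directed (multi)graph whose arcs carry a transit time and a capacity. -/
structure Network (V E : Type*) where
  src : E → V
  tgt : E → V
  /-- transit times -/
  tau : E → ℝ
  /-- capacities -/
  nu : E → ℝ
  tau_pos : ∀ e, 0 < tau e
  nu_pos : ∀ e, 0 < nu e

namespace Network

variable {V E : Type*} (N : Network V E)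

/-- The nodes visited by a list of consecutive arcs, in order. -/
def pathNodes : List E → List V
  | [] => []
  | e :: l => N.src e :: (e :: l).map N.tgt

/-- `p` is a simple `o`-`d`-path with at least one arc (no node is visited twice). -/
structure IsSimplePath (o d : V) (p : List E) : Prop where
  starts : p.head?.map N.src = some o
  ends : p.getLast?.map N.tgt = some d
  chain : p.IsChain (fun a b => N.tgt a = N.src b)
  simple : (N.pathNodes p).Nodup

end Network

/-- A commodity: an origin, a destination, a fixed simple path between them and a supply rate, of
which only the values on `[0, ∞)` matter. -/
structure Commodity {V E : Type*} (N : Network V E) where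
  origin : V
  dest : V
  path : List E
  isSimplePath : N.IsSimplePath origin dest path
  supply : ℝ → ℝ
  supply_nonneg : ∀ θ, 0 ≤ θ → 0 ≤ supply θ
  supply_integrable : IntegrableOn supply (Set.Ici 0)
  supply_bounded : ∃ B, ∀ θ, 0 ≤ θ → supply θ ≤ B
  supply_support : ∃ H, ∀ θ, H < θ → supply θ = 0

namespace Commodity

variable {V E : Type*} {N : Network V E}

/-- The total flow volume `m_j`; the particles of the commodity are the points of `[0, m_j]`. -/
noncomputable def mass (c : Commodity N) : ℝ := ∫ ξ in Set.Ici 0, c.supply ξ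

/-- The time at which the particle `φ` is released at the origin. -/
noncomputable def releaseTime (c : Commodity N) (φ : ℝ) : ℝ :=
  sInf {θ : ℝ | 0 ≤ θ ∧ ∫ ξ in (0 : ℝ)..θ, c.supply ξ = φ}

/-- The number of packets of size `β`; the packets are `1, …, ⌊m_j / β⌋`. -/
noncomputable def numPackets (c : Commodity N) (β : ℝ) : ℕ := ⌊c.mass / β⌋₊

/-- The time step in which packet `i` is released. -/
noncomputable def releaseStep (c : Commodity N) (α β : ℝ) (i : ℕ) : ℕ :=
  sInf {t : ℕ | (i : ℝ) * β ≤ ∫ ξ in (0 : ℝ)..(α * t), c.supply ξ}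

end Commodity

/-! ### Flows over time -/

/-- In- and outflow rates `f⁺_{j,e}` and `f⁻_{j,e}`. -/
structure FlowRates (J E : Type*) where
  inRate : J → E → ℝ → ℝ
  outRate : J → E → ℝ → ℝ

namespace FlowRates

variable {J V E : Type*} (f : FlowRates J E)

/-- Cumulative inflow `F⁺_{j,e}`. -/
noncomputable def cumIn (j : J) (e : E) (θ : ℝ) : ℝ := ∫ ξ in (0 : ℝ)..θ, f.inRate j e ξ

/-- Cumulative outflow `F⁻_{j,e}`. -/
noncomputable def cumOut (j : J) (e : E) (θ : ℝ) : ℝ := ∫ ξ in (0 : ℝ)..θ, f.outRate j e ξ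

/-- Every commodity uses its own path only. -/
def UsesPaths {N : Network V E} (C : J → Commodity N) : Prop :=
  ∀ j e, e ∉ (C j).path → (∀ᵐ θ, f.inRate j e θ = 0) ∧ (∀ᵐ θ, f.outRate j e θ = 0)

variable [Fintype J] (N : Network V E)

/-- Total inflow rate `f⁺_e`. -/
noncomputable def totalIn (e : E) (θ : ℝ) : ℝ := ∑ j, f.inRate j e θ

/-- Total outflow rate `f⁻_e`. -/
noncomputable def totalOut (e : E) (θ : ℝ) : ℝ := ∑ j, f.outRate j e θ

/-- Queue size `z_e(θ) = F⁺_e(θ - τ_e) - F⁻_e(θ)`. -/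
noncomputable def queueSize (e : E) (θ : ℝ) : ℝ :=
  ∑ j, f.cumIn j e (θ - N.tau e) - ∑ j, f.cumOut j e θ

/-- Waiting time `q_e(θ)` of the particles that enter `e` at time `θ`. -/
noncomputable def waitingTime (e : E) (θ : ℝ) : ℝ := f.queueSize N e (θ + N.tau e) / N.nu e

/-- Exit time `T_e(θ)` of the particles that enter `e` at time `θ`. -/
noncomputable def exitTime (e : E) (θ : ℝ) : ℝ := θ + N.tau e + f.waitingTime N e θ

/-- The earliest entrance time of the particles that leave `e` at time `θ`. -/
noncomputable def entranceTime (e : E) (θ : ℝ) : ℝ :=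
  sInf {ξ : ℝ | ξ ≤ θ ∧ f.exitTime N e ξ = θ}

/-- Feasible multi-commodity flow over time for the commodities `C`. -/
structure IsFeasible [Fintype E] [DecidableEq V] (C : J → Commodity N) : Prop where
  in_nonneg : ∀ j e θ, 0 ≤ f.inRate j e θ
  out_nonneg : ∀ j e θ, 0 ≤ f.outRate j e θ
  in_bounded : ∀ j e, ∃ B, ∀ θ, f.inRate j e θ ≤ B
  out_bounded : ∀ j e, ∃ B, ∀ θ, f.outRate j e θ ≤ B
  in_locallyIntegrable : ∀ j e, LocallyIntegrable (f.inRate j e)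
  out_locallyIntegrable : ∀ j e, LocallyIntegrable (f.outRate j e)
  in_neg : ∀ j e θ, θ < 0 → f.inRate j e θ = 0
  out_neg : ∀ j e θ, θ < 0 → f.outRate j e θ = 0
  /-- flow conservation -/
  conservation : ∀ j v, ∀ᵐ θ, 0 ≤ θ →
    (v ≠ (C j).origin → v ≠ (C j).dest →
      ∑ e with N.src e = v, f.inRate j e θ - ∑ e with N.tgt e = v, f.outRate j e θ = 0) ∧
    (v = (C j).origin →
      ∑ e with N.src e = v, f.inRate j e θ - ∑ e with N.tgt e = v, f.outRate j e θ
        = (C j).supply θ) ∧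
    (v = (C j).dest →
      ∑ e with N.src e = v, f.inRate j e θ - ∑ e with N.tgt e = v, f.outRate j e θ ≤ 0)
  /-- the queue operates at capacity rate (the second case is the case of an empty queue:
  this law forces the queue size to be nonnegative) -/
  outflow : ∀ e, ∀ᵐ θ, 0 ≤ θ →
    f.totalOut e θ =
      if 0 < f.queueSize N e θ then N.nu e else min (f.totalIn e (θ - N.tau e)) (N.nu e)
  /-- first in first out: the commodities leave in the proportions in which they entered -/
  fifo : ∀ j e, ∀ᵐ θ, 0 ≤ θ →
    f.outRate j e θ =
      if 0 < f.totalIn e (f.entranceTime N e θ) then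
        f.totalOut e θ *
          (f.inRate j e (f.entranceTime N e θ) / f.totalIn e (f.entranceTime N e θ))
      else 0

/-- The arrival time `ℓ_{j,v}(φ)` of particle `φ` of commodity `j` at the node `v` of its path: the
exit time functions of the arcs before `v` are applied, one after the other, to the release
time. -/
noncomputable def arrivalTime [DecidableEq V] (C : J → Commodity N) (j : J) (v : V) (φ : ℝ) : ℝ :=
  ((C j).path.takeWhile (fun e => N.src e ≠ v)).foldl (fun θ e => f.exitTime N e θ)
    ((C j).releaseTime φ)

end FlowRates

/-! ### The packet routing model -/

/-- The run of the merging loop. `y i` is the initial number of packets in the line `i`, `Y i` is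
what is left of this line and `a i` is its priority counter. As long as there are packets left, the
first packet of a nonempty line with minimal counter is moved to the end of the merged list, and the
counter of this line is increased by `1 / y i`. Ties may be broken in any way. -/
inductive ZipperRun {ι P : Type*} [DecidableEq ι] (y : ι → ℕ) :
    (ι → List P) → (ι → ℚ) → List P → Prop
  | done (Y : ι → List P) (a : ι → ℚ) (h : ∀ i, Y i = []) : ZipperRun y Y a []
  | step (Y : ι → List P) (a : ι → ℚ) (i : ι) (p : P) (rest L : List P)
      (hp : Y i = p :: rest)
      (hmin : ∀ i', Y i' ≠ [] → a i ≤ a i')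
      (hL : ZipperRun y (Function.update Y i rest) (Function.update a i (a i + 1 / (y i : ℚ))) L) :
      ZipperRun y Y a (p :: L)

/-- `L` is a result of the zipper-like merging of the lines `Y i`. -/
def IsZipperMerge {ι P : Type*} [DecidableEq ι] (Y : ι → List P) (L : List P) : Prop :=
  ZipperRun (fun i => (Y i).length) Y (fun i => 1 / ((Y i).length : ℚ)) L

/-- The data of a network loading. A packet is a pair of a commodity and an index, and the front of
a line is the head of the list. -/
structure Loading (J V E : Type*) where
  /-- the packets on an arc at a time step, with their arc entrance time steps -/
  queue : ℕ → E → List ((J × ℕ) × ℕ)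
  /-- current capacities -/
  cap : ℕ → E → ℝ
  /-- packets released at a node -/
  released : ℕ → V → List (J × ℕ)
  /-- packets entering an arc -/
  entering : ℕ → E → List (J × ℕ)

namespace Loading

variable {J V E : Type*} (X : Loading J V E) (N : Network V E) (C : J → Commodity N) (α β : ℝ)

/-- The buffer: the packets that have spent at least `⌈τ_e / α⌉` time steps on the arc. -/
noncomputable def buffer (t : ℕ) (e : E) : List ((J × ℕ) × ℕ) :=
  (X.queue t e).takeWhile (fun q => q.2 + ⌈N.tau e / α⌉₊ ≤ t)

/-- The leaving packets: as many packets from the front of the buffer as the current capacity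
permits. -/
noncomputable def leaving (t : ℕ) (e : E) : List (J × ℕ) :=
  ((X.buffer N α t e).take ⌊X.cap t e⌋₊).map Prod.fst

open Classical in
/-- The lines of packets that want to enter `e` in time step `t`: for each arc `e'` the leaving
packets of `e'` on whose path `e` comes directly after `e'`, and (at `none`) the packets released at
the tail of `e` whose path starts with `e`. -/
noncomputable def lines (t : ℕ) (e : E) : Option E → List (J × ℕ)
  | some e' => (X.leaving N α t e').filter (fun p => [e', e] <:+: (C p.1).path)
  | none => (X.released t (N.src e)).filter (fun p => (C p.1).path.head? = some e)

/-- `X` is a network loading with time steps of length `α` and packets of size `β`. The numbering of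
packets of different commodities and the breaking of ties are arbitrary. -/
structure IsNetworkLoading [DecidableEq E] : Prop where
  queue_zero : ∀ e, X.queue 0 e = []
  cap_zero : ∀ e, X.cap 0 e = N.nu e * α / β
  mem_released : ∀ t v j i, (j, i) ∈ X.released t v ↔
    (C j).origin = v ∧ 1 ≤ i ∧ i ≤ (C j).numPackets β ∧ (C j).releaseStep α β i = t
  released_order : ∀ t v, (X.released t v).Pairwise (fun p q => p.1 = q.1 → p.2 < q.2)
  transition : ∀ t e, IsZipperMerge (X.lines N C α t e) (X.entering t e)
  queue_succ : ∀ t e, X.queue (t + 1) e =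
    (X.queue t e).drop (X.leaving N α t e).length ++ (X.entering t e).map (fun p => (p, t))
  cap_succ : ∀ t e, X.cap (t + 1) e =
    if ((X.buffer N α t e).length : ℝ) ≤ X.cap t e then N.nu e * α / β
    else N.nu e * α / β + X.cap t e - ⌊X.cap t e⌋

open Classical in
/-- Inflow rate `g⁺_{j,e}`, constant during each time step `(α (t - 1), α t]`. -/
noncomputable def inRate (j : J) (e : E) (θ : ℝ) : ℝ :=
  β / α * (X.entering ⌈θ / α⌉₊ e).countP (fun p => p.1 = j)

open Classical in
/-- Outflow rate `g⁻_{j,e}`. -/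
noncomputable def outRate (j : J) (e : E) (θ : ℝ) : ℝ :=
  β / α * (X.leaving N α ⌈θ / α⌉₊ e).countP (fun p => p.1 = j)

/-- Cumulative inflow `G⁺_{j,e}`. -/
noncomputable def cumIn (j : J) (e : E) (θ : ℝ) : ℝ := ∫ ξ in (0 : ℝ)..θ, X.inRate α β j e ξ

/-- Cumulative outflow `G⁻_{j,e}`. -/
noncomputable def cumOut (j : J) (e : E) (θ : ℝ) : ℝ := ∫ ξ in (0 : ℝ)..θ, X.outRate N α β j e ξ

/-- The cumulative flow of commodity `j` through the node `v` of its path: the cumulative inflow of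
the arc of the path that starts in `v`, or, if `v` is the destination, the cumulative outflow of the
last arc. -/
noncomputable def cumThrough [DecidableEq V] (j : J) (v : V) (θ : ℝ) : ℝ :=
  match (C j).path.find? (fun e => N.src e = v), (C j).path.getLast? with
  | some e, _ => X.cumIn α β j e θ
  | none, some e => X.cumOut N α β j e θ
  | none, none => 0

/-- The points in time at which the first `i` packets of commodity `j` have passed the node `v`. -/
def passedTimes [DecidableEq V] (j : J) (v : V) (i : ℕ) : Set ℝ :=
  {θ : ℝ | 0 ≤ θ ∧ (i : ℝ) * β ≤ X.cumThrough N C α β j v θ}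

/-- The refined arrival time `ℓᴰ_{j,v}(i)` of packet `i` of commodity `j` at `v`. -/
noncomputable def arrivalTime [DecidableEq V] (j : J) (v : V) (i : ℕ) : ℝ :=
  sInf (X.passedTimes N C α β j v i)

end Loading

/-! On a single arc both models obey the same min-formula. If `A` is the cumulative inflow of a
deterministic queue, its cumulative outflow at `θ` is the minimum over `ξ ∈ [0, θ]` of `A (ξ - τ) +
ν (θ - ξ)`, attained at the last moment at which the queue is empty
(`IsQueueFlow.cumulative_out_le_add`, `IsQueueFlow.exists_cumulative_out_eq`). In the packet model
the fractional part of the capacity is carried over while the arc is busy, so the number of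
departures obeys the analogous formula with delay `⌈τ / α⌉` and `ν α / β` packets per step, up to
one packet (`numLeft_le_add`, `exists_numLeft_ge`). Hence total inflows that are `δ`-close up to
time `H` give total outflows that are close up to `H + τ`, with error `δ + ν α + β`
(`abs_numLeft_sub_cumulative_le`).

First in first out transfers this to the single commodities. In the flow, the entrance time map
pushes the outflow measure forward to the inflow measure, so what commodity `j` has sent in by `ξ`
equals what it has received by the exit time of `ξ` (`cumulative_part_queueExit`). In the packet
model, the packets that have left form a prefix of the packets that have entered, and two prefixes
of one sequence differ in every commodity by at most their difference in length
(`abs_outCount_sub_inCount_le`).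

Along a path, the outflow of an arc is the inflow of the next one, and the inflow of the first arc
is the supply, up to rounding. Closeness up to `H` therefore yields closeness up to `H + min τ`,
even if the paths run through cycles of the network, and finitely many such extensions reach any
horizon (`InflowConverges.step`, `inflowConverges`). Of the merging rule only the fact that it
neither loses nor duplicates packets is needed. Since all cumulative functions are monotone and end
at a common bounded volume, convergence on the time grid becomes uniform on `[0, ∞)`.

For `φ > 0`, the arrival time is the first time at which the cumulative flow through the node
reaches `φ` (`passTime_spec`). Convergence of the cumulative functions thus bounds the packet
arrival times from below in the limit, and from above wherever the arrival time is continuous from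
the right, by comparison with a slightly later particle. At a jump the cumulative flow rests at the
level `φ`, and a deficit of a single packet could delay the arrival by the whole jump. If `φ` is a
multiple of `β` no deficit occurs: shortly after the exit time of `ξ`, exactly all packets that
entered by `ξ` have left, because a busy arc working for a further time `ε` makes up for every
vanishing error (`eventually_numEntered_le_numLeft`, `eventually_le_passCount`). -/

/-! ### Rates and their cumulative functions -/

/-- A nonnegative, bounded, locally integrable function that vanishes for negative times. -/
structure IsRate (g : ℝ → ℝ) : Prop where
  nonneg : ∀ θ, 0 ≤ g θ
  bounded : ∃ B, ∀ θ, g θ ≤ B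
  locallyIntegrable : LocallyIntegrable g
  neg : ∀ θ, θ < 0 → g θ = 0

/-- The cumulative function of a rate. -/
noncomputable def cumulative (g : ℝ → ℝ) (θ : ℝ) : ℝ := ∫ ξ in (0 : ℝ)..θ, g ξ

namespace IsRate

variable {g : ℝ → ℝ} (hg : IsRate g)
include hg

theorem intervalIntegrable (a b : ℝ) : IntervalIntegrable g volume a b :=
  (hg.locallyIntegrable.integrableOn_isCompact isCompact_uIcc).intervalIntegrable

theorem cumulative_sub (a b : ℝ) : cumulative g b - cumulative g a = ∫ ξ in a..b, g ξ :=
  intervalIntegral.integral_interval_sub_left (hg.intervalIntegrable _ _) (hg.intervalIntegrable _ _)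

theorem cumulative_mono : Monotone (cumulative g) := by
  intro a b hab
  have := hg.cumulative_sub a b
  have h2 : 0 ≤ ∫ ξ in a..b, g ξ := intervalIntegral.integral_nonneg hab fun u _ => hg.nonneg u
  linarith

theorem cumulative_of_nonpos {θ : ℝ} (hθ : θ ≤ 0) : cumulative g θ = 0 := by
  unfold cumulative
  rw [intervalIntegral.integral_symm, neg_eq_zero, intervalIntegral.integral_of_le hθ,
    integral_Ioc_eq_integral_Ioo]
  exact setIntegral_eq_zero_of_forall_eq_zero fun x hx => hg.neg x hx.2

theorem cumulative_nonneg (θ : ℝ) : 0 ≤ cumulative g θ := by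
  rcases le_total θ 0 with h | h
  · rw [hg.cumulative_of_nonpos h]
  · have := hg.cumulative_mono h
    rwa [hg.cumulative_of_nonpos le_rfl] at this

theorem continuous_cumulative : Continuous (cumulative g) :=
  intervalIntegral.continuous_primitive hg.intervalIntegrable 0

theorem cumulative_lipschitz {B : ℝ} (hB : ∀ θ, g θ ≤ B) {a b : ℝ} (hab : a ≤ b) :
    cumulative g b - cumulative g a ≤ B * (b - a) := by
  rw [hg.cumulative_sub]
  have := intervalIntegral.integral_mono_on hab (hg.intervalIntegrable a b)
    (intervalIntegrable_const (c := B)) fun x _ => hB x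
  simpa [mul_comm] using this

end IsRate

theorem IsRate.sum {ι : Type*} [Fintype ι] {g : ι → ℝ → ℝ} (hg : ∀ i, IsRate (g i)) :
    IsRate (fun θ => ∑ i, g i θ) where
  nonneg θ := Finset.sum_nonneg fun i _ => (hg i).nonneg θ
  bounded := by
    choose B hB using fun i => (hg i).bounded
    exact ⟨∑ i, B i, fun θ => Finset.sum_le_sum fun i _ => hB i θ⟩
  locallyIntegrable := by
    have := locallyIntegrable_finsetSum' (μ := volume) (Finset.univ : Finset ι) (f := g)
      fun i _ => (hg i).locallyIntegrable
    have he : ∑ i, g i = fun θ => ∑ i, g i θ := by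
      ext θ
      simp
    rwa [he] at this
  neg θ hθ := Finset.sum_eq_zero fun i _ => (hg i).neg θ hθ

theorem cumulative_sum {ι : Type*} [Fintype ι] {g : ι → ℝ → ℝ} (hg : ∀ i, IsRate (g i)) (θ : ℝ) :
    cumulative (fun θ => ∑ i, g i θ) θ = ∑ i, cumulative (g i) θ :=
  intervalIntegral.integral_finsetSum fun i _ => (hg i).intervalIntegrable _ _

/-! ### A single deterministic queue -/

/-- The in- and outflow rates `a` and `b` of an arc with transit time `τ` and capacity `ν`. -/
structure IsQueueFlow (τ ν : ℝ) (a b : ℝ → ℝ) : Prop where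
  tau_pos : 0 < τ
  nu_pos : 0 < ν
  inflow : IsRate a
  outflow : IsRate b
  law : ∀ᵐ θ, 0 ≤ θ →
    b θ = if 0 < cumulative a (θ - τ) - cumulative b θ then ν else min (a (θ - τ)) ν

namespace IsQueueFlow

variable {τ ν : ℝ} {a b : ℝ → ℝ} (h : IsQueueFlow τ ν a b)
include h

theorem outflow_le : ∀ᵐ θ, b θ ≤ ν := by
  filter_upwards [h.law] with θ hθ
  rcases lt_or_ge θ 0 with h0 | h0
  · rw [h.outflow.neg θ h0]; exact h.nu_pos.le
  · rw [hθ h0]; split_ifs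
    · exact le_rfl
    · exact min_le_right _ _

theorem cumulative_out_sub_le {s t : ℝ} (hst : s ≤ t) :
    cumulative b t - cumulative b s ≤ ν * (t - s) := by
  rw [h.outflow.cumulative_sub]
  have := intervalIntegral.integral_mono_ae hst (h.outflow.intervalIntegrable s t)
    (intervalIntegrable_const (c := ν)) h.outflow_le
  simpa [mul_comm] using this

theorem continuous_queue : Continuous fun θ => cumulative a (θ - τ) - cumulative b θ :=
  (h.inflow.continuous_cumulative.comp (continuous_id.sub continuous_const)).sub
    h.outflow.continuous_cumulative

/-- The outflow of an arc does not exceed its delayed inflow. -/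
theorem cumulative_out_le (θ : ℝ) : cumulative b θ ≤ cumulative a (θ - τ) := by
  by_contra! hlt
  set z : ℝ → ℝ := fun θ => cumulative a (θ - τ) - cumulative b θ with hz
  have hzθ : z θ < 0 := by simp only [hz]; linarith
  have h0 : 0 < θ := by
    by_contra! h0
    rw [h.outflow.cumulative_of_nonpos h0] at hlt
    exact absurd hlt (not_lt.2 (h.inflow.cumulative_nonneg _))
  -- After the last time `ξ` with nonnegative queue the second case of the law applies, so the
  -- outflow rate is at most the delayed inflow rate and the queue cannot fall below its value at
  -- `ξ`.
  set S : Set ℝ := Set.Icc 0 θ ∩ {s | 0 ≤ z s} with hS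
  have hSc : IsCompact S :=
    isCompact_Icc.inter_right (isClosed_le continuous_const h.continuous_queue)
  have hz0 : 0 ≤ z 0 := by
    simp only [hz]
    rw [h.outflow.cumulative_of_nonpos le_rfl, sub_zero]
    exact h.inflow.cumulative_nonneg _
  have hSne : S.Nonempty := ⟨0, ⟨le_rfl, h0.le⟩, hz0⟩
  obtain ⟨ξ, ⟨⟨hξ0, hξθ⟩, hξz⟩, hmax⟩ := hSc.exists_isGreatest hSne
  have hneg : ∀ s ∈ Set.Ioc ξ θ, z s < 0 := by
    intro s hs
    by_contra! hc
    exact absurd (hmax ⟨⟨hξ0.trans hs.1.le, hs.2⟩, hc⟩) (not_le.2 hs.1)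
  have hle : cumulative b θ - cumulative b ξ ≤ cumulative a (θ - τ) - cumulative a (ξ - τ) := by
    rw [h.outflow.cumulative_sub, h.inflow.cumulative_sub, ← intervalIntegral.integral_comp_sub_right,
      intervalIntegral.integral_of_le hξθ, intervalIntegral.integral_of_le hξθ]
    have hi : IntervalIntegrable (fun x => a (x - τ)) volume ξ θ := by
      have := (h.inflow.intervalIntegrable (ξ - τ) (θ - τ)).comp_sub_right τ
      simpa using this
    refine setIntegral_mono_on_ae
      ((intervalIntegrable_iff_integrableOn_Ioc_of_le hξθ).1 (h.outflow.intervalIntegrable ξ θ))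
      ((intervalIntegrable_iff_integrableOn_Ioc_of_le hξθ).1 hi) measurableSet_Ioc ?_
    filter_upwards [h.law] with s hs hsI
    have h1 := hneg s hsI
    simp only [hz] at h1
    rw [hs (hξ0.trans hsI.1.le), if_neg h1.not_gt]
    exact min_le_left _ _
  have h2 : 0 ≤ cumulative a (ξ - τ) - cumulative b ξ := hξz
  simp only [hz] at hzθ
  linarith

/-- While there is a queue, an arc works at capacity. -/
theorem cumulative_out_of_queue {s t : ℝ} (hs : 0 ≤ s) (hst : s ≤ t)
    (hpos : ∀ x ∈ Set.Ioo s t, cumulative b x < cumulative a (x - τ)) :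
    cumulative b t - cumulative b s = ν * (t - s) := by
  rw [h.outflow.cumulative_sub, intervalIntegral.integral_of_le hst, integral_Ioc_eq_integral_Ioo]
  rw [setIntegral_congr_ae (g := fun _ => ν) measurableSet_Ioo]
  · simp [hst, mul_comm]
  · filter_upwards [h.law] with x hx hxI
    rw [hx (hs.trans hxI.1.le), if_pos (sub_pos.2 (hpos x hxI))]

/-- One half of the min-formula: up to `ξ` the outflow is bounded by the delayed inflow, after `ξ`
by the capacity. -/
theorem cumulative_out_le_add {ξ θ : ℝ} (hξ : ξ ≤ θ) :
    cumulative b θ ≤ cumulative a (ξ - τ) + ν * (θ - ξ) := by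
  linarith [h.cumulative_out_le ξ, h.cumulative_out_sub_le hξ]

/-- The other half of the min-formula: at the last time `ξ ≤ θ` with an empty queue all delayed
inflow has left, and from then on the arc works at capacity. Such a time exists because the queue is
empty at time `0`. -/
theorem exists_cumulative_out_eq {θ : ℝ} (hθ : 0 ≤ θ) :
    ∃ ξ, 0 ≤ ξ ∧ ξ ≤ θ ∧ cumulative b θ = cumulative a (ξ - τ) + ν * (θ - ξ) := by
  have hSc : IsCompact (Set.Icc 0 θ ∩ {s | cumulative a (s - τ) - cumulative b s = 0}) :=
    isCompact_Icc.inter_right (isClosed_eq h.continuous_queue continuous_const)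
  have hSne : (Set.Icc 0 θ ∩ {s | cumulative a (s - τ) - cumulative b s = 0}).Nonempty := by
    refine ⟨0, ⟨le_rfl, hθ⟩, ?_⟩
    simp only [Set.mem_ofPred_eq]
    rw [h.outflow.cumulative_of_nonpos le_rfl, h.inflow.cumulative_of_nonpos
      (by linarith [h.tau_pos]), sub_zero]
  obtain ⟨ξ, ⟨⟨hξ0, hξθ⟩, hξz⟩, hmax⟩ := hSc.exists_isGreatest hSne
  refine ⟨ξ, hξ0, hξθ, ?_⟩
  have := h.cumulative_out_of_queue hξ0 hξθ fun s hs => ?_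
  · simp only [Set.mem_ofPred_eq] at hξz
    linarith
  · refine lt_of_le_of_ne (h.cumulative_out_le s) fun he => ?_
    exact absurd (hmax ⟨⟨hξ0.trans hs.1.le, hs.2.le⟩, by simp [he]⟩) (not_le.2 hs.1)

end IsQueueFlow

/-! ### Exit and entrance times -/

/-- The exit time of the particles that enter at time `ξ`. -/
noncomputable def queueExit (τ ν : ℝ) (a b : ℝ → ℝ) (ξ : ℝ) : ℝ :=
  ξ + τ + (cumulative a ξ - cumulative b (ξ + τ)) / ν

/-- The earliest entrance time of the particles that exit at time `θ`. -/
noncomputable def queueEntrance (τ ν : ℝ) (a b : ℝ → ℝ) (θ : ℝ) : ℝ :=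
  sInf {ξ : ℝ | ξ ≤ θ ∧ queueExit τ ν a b ξ = θ}

namespace IsQueueFlow

variable {τ ν : ℝ} {a b : ℝ → ℝ} (h : IsQueueFlow τ ν a b)
include h

theorem continuous_queueExit : Continuous (queueExit τ ν a b) := by
  unfold queueExit
  have h1 := h.inflow.continuous_cumulative
  have h2 := h.outflow.continuous_cumulative
  fun_prop

theorem nu_mul_queueExit (ξ : ℝ) :
    ν * (queueExit τ ν a b ξ - (ξ + τ)) = cumulative a ξ - cumulative b (ξ + τ) := by
  unfold queueExit
  have := h.nu_pos.ne'
  field_simp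
  ring

theorem le_queueExit (ξ : ℝ) : ξ + τ ≤ queueExit τ ν a b ξ := by
  have h1 := h.nu_mul_queueExit ξ
  have h2 := h.cumulative_out_le (ξ + τ)
  rw [add_sub_cancel_right] at h2
  have := h.nu_pos
  by_contra! hc
  nlinarith

/-- While the entrance time grows by `Δ`, the inflow term does not decrease and the outflow term
lowers the waiting time by at most `Δ`, since the outflow rate is at most `ν`. -/
theorem queueExit_mono : Monotone (queueExit τ ν a b) := by
  intro s t hst
  have h1 := h.nu_mul_queueExit s
  have h2 := h.nu_mul_queueExit t
  have h3 := h.inflow.cumulative_mono hst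
  have h4 := h.cumulative_out_sub_le (s := s + τ) (t := t + τ) (by linarith)
  have := h.nu_pos
  by_contra! hc
  nlinarith

theorem cumulative_out_of_neg {θ : ℝ} (hθ : θ ≤ τ) : cumulative b θ = 0 := by
  have h1 := h.cumulative_out_le θ
  rw [h.inflow.cumulative_of_nonpos (by linarith)] at h1
  exact le_antisymm h1 (h.outflow.cumulative_nonneg _)

theorem queueExit_of_nonpos {ξ : ℝ} (hξ : ξ ≤ 0) : queueExit τ ν a b ξ = ξ + τ := by
  unfold queueExit
  rw [h.inflow.cumulative_of_nonpos hξ, h.cumulative_out_of_neg (by linarith)]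
  simp

/-- Strictly between `ξ + τ` and the exit time the arc, even at full rate, has not yet released
`cumulative a ξ`. So the queue is nonempty there, the arc works at capacity, and by the definition
of the exit time exactly this volume has then left. -/
theorem cumulative_out_queueExit (ξ : ℝ) :
    cumulative b (queueExit τ ν a b ξ) = cumulative a ξ := by
  rcases le_total ξ 0 with h0 | h0
  · rw [h.queueExit_of_nonpos h0, h.cumulative_out_of_neg (by linarith),
      h.inflow.cumulative_of_nonpos h0]
  have h1 := h.nu_mul_queueExit ξ
  have := h.cumulative_out_of_queue (s := ξ + τ) (by linarith [h.tau_pos]) (h.le_queueExit ξ)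
    fun x hx => ?_
  · linarith
  · have h2 := h.inflow.cumulative_mono (show ξ ≤ x - τ by linarith [hx.1])
    have h3 := h.cumulative_out_sub_le hx.1.le
    have := mul_lt_mul_of_pos_left hx.2 h.nu_pos
    linarith

theorem isLeast_queueEntrance (θ : ℝ) :
    IsLeast {ξ : ℝ | ξ ≤ θ ∧ queueExit τ ν a b ξ = θ} (queueEntrance τ ν a b θ) := by
  have hclosed : IsClosed {ξ : ℝ | ξ ≤ θ ∧ queueExit τ ν a b ξ = θ} :=
    (isClosed_le continuous_id continuous_const).inter
      (isClosed_eq h.continuous_queueExit continuous_const)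
  -- Entrance times may be negative, but there the exit time is just `ξ + τ`; this bounds the set
  -- from below and makes the infimum a minimum.
  have hlow : ∀ ξ, queueExit τ ν a b ξ = θ → min (θ - τ) 0 ≤ ξ := by
    intro ξ hξ
    rcases le_total ξ 0 with h0 | h0
    · rw [h.queueExit_of_nonpos h0] at hξ
      exact (min_le_left _ _).trans (by linarith)
    · exact (min_le_right _ _).trans h0
  have hup : ∀ ξ, queueExit τ ν a b ξ = θ → ξ ≤ θ := by
    intro ξ hξ
    linarith [h.le_queueExit ξ, h.tau_pos]
  refine hclosed.isLeast_csInf ?_ ⟨min (θ - τ) 0, fun ξ hξ => hlow ξ hξ.2⟩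
  have h1 : queueExit τ ν a b (min (θ - τ) 0) ≤ θ := by
    rw [h.queueExit_of_nonpos (min_le_right _ _)]
    linarith [min_le_left (θ - τ) 0]
  have h2 : θ ≤ queueExit τ ν a b θ := by linarith [h.le_queueExit θ, h.tau_pos]
  obtain ⟨ξ, hξ⟩ := mem_range_of_exists_le_of_exists_ge h.continuous_queueExit ⟨_, h1⟩ ⟨_, h2⟩
  exact ⟨ξ, hup ξ hξ, hξ⟩

theorem queueExit_queueEntrance (θ : ℝ) :
    queueExit τ ν a b (queueEntrance τ ν a b θ) = θ := (h.isLeast_queueEntrance θ).1.2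

/-- Entrance and exit time form a Galois connection. In particular, preimages of half-lines under
the entrance time are half-lines, which identifies the pushforward measure below. -/
theorem queueEntrance_le_iff (θ ξ : ℝ) :
    queueEntrance τ ν a b θ ≤ ξ ↔ θ ≤ queueExit τ ν a b ξ := by
  constructor
  · intro hle
    have := h.queueExit_mono hle
    rwa [h.queueExit_queueEntrance] at this
  · intro hle
    by_contra! hlt
    have h1 := h.queueExit_mono hlt.le
    rw [h.queueExit_queueEntrance] at h1
    have h2 := le_antisymm h1 hle
    have := (h.isLeast_queueEntrance θ).2
      ⟨by linarith [h.le_queueExit ξ, h.tau_pos], h2⟩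
    linarith

theorem queueEntrance_mono : Monotone (queueEntrance τ ν a b) := by
  intro s t hst
  rw [h.queueEntrance_le_iff, h.queueExit_queueEntrance]
  exact hst

end IsQueueFlow

/-! ### Change of variables along the entrance time -/

theorem IsRate.integrableOn_Iic {g : ℝ → ℝ} (hg : IsRate g) (θ : ℝ) :
    IntegrableOn g (Set.Iic θ) := by
  have h0 : IntegrableOn g (Set.Iic 0) := by
    rw [integrableOn_Iic_iff_integrableOn_Iio]
    exact integrableOn_zero.congr_fun (fun x hx => (hg.neg x hx).symm) measurableSet_Iio
  rcases le_total θ 0 with h | h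
  · exact h0.mono_set (Set.Iic_subset_Iic.2 h)
  · rw [← Set.Iic_union_Ioc_eq_Iic h]
    exact h0.union ((intervalIntegrable_iff_integrableOn_Ioc_of_le h).1 (hg.intervalIntegrable 0 θ))

theorem IsRate.lintegral_Iic {g : ℝ → ℝ} (hg : IsRate g) (θ : ℝ) :
    ∫⁻ x in Set.Iic θ, ENNReal.ofReal (g x) = ENNReal.ofReal (cumulative g θ) := by
  rw [← ofReal_integral_eq_lintegral_ofReal (hg.integrableOn_Iic θ)
    (Eventually.of_forall hg.nonneg)]
  congr 1
  have h1 := intervalIntegral.integral_Iic_sub_Iic (hg.integrableOn_Iic 0) (hg.integrableOn_Iic θ)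
  have h2 : ∫ x in Set.Iic 0, g x = 0 := by
    rw [integral_Iic_eq_integral_Iio]
    exact setIntegral_eq_zero_of_forall_eq_zero fun x hx => hg.neg x hx
  rw [h2, sub_zero] at h1
  exact h1

namespace IsQueueFlow

variable {τ ν : ℝ} {a b : ℝ → ℝ} (h : IsQueueFlow τ ν a b)
include h

/-- The entrance time map pushes the outflow measure forward to the inflow measure. -/
theorem map_queueEntrance (ξ : ℝ) :
    ((volume.restrict (Set.Iic (queueExit τ ν a b ξ))).withDensity
      (fun x => ENNReal.ofReal (b x))).map (queueEntrance τ ν a b) =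
    (volume.restrict (Set.Iic ξ)).withDensity (fun x => ENNReal.ofReal (a x)) := by
  have hm : Measurable (queueEntrance τ ν a b) := h.queueEntrance_mono.measurable
  have : IsFiniteMeasure ((volume.restrict (Set.Iic (queueExit τ ν a b ξ))).withDensity
      (fun x => ENNReal.ofReal (b x))) := by
    refine isFiniteMeasure_withDensity ?_
    rw [h.outflow.lintegral_Iic]
    exact ENNReal.ofReal_ne_top
  -- A finite measure on the line is determined by its values on half-lines, and these agree because
  -- the outflow up to the exit time of `x` is the inflow up to `x`.
  refine Measure.ext_of_Iic _ _ fun x => ?_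
  have hpre : queueEntrance τ ν a b ⁻¹' Set.Iic x = Set.Iic (queueExit τ ν a b x) := by
    ext s
    exact h.queueEntrance_le_iff s x
  rw [Measure.map_apply hm measurableSet_Iic, hpre, withDensity_apply _ measurableSet_Iic,
    withDensity_apply _ measurableSet_Iic, Measure.restrict_restrict measurableSet_Iic,
    Measure.restrict_restrict measurableSet_Iic, Set.Iic_inter_Iic, Set.Iic_inter_Iic,
    h.outflow.lintegral_Iic, h.inflow.lintegral_Iic]
  congr 1
  rw [← h.queueExit_mono.map_min, h.cumulative_out_queueExit]

/-- First in first out: the part `aⱼ` of the inflow that has entered up to time `ξ` is the part that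
has left up to the exit time. -/
theorem cumulative_part_queueExit {aj bj : ℝ → ℝ} (haj : IsRate aj) (hbj : IsRate bj)
    (hle : ∀ x, aj x ≤ a x)
    (hfifo : ∀ᵐ θ, 0 ≤ θ → bj θ = if 0 < a (queueEntrance τ ν a b θ) then
      b θ * (aj (queueEntrance τ ν a b θ) / a (queueEntrance τ ν a b θ)) else 0) (ξ : ℝ) :
    cumulative bj (queueExit τ ν a b ξ) = cumulative aj ξ := by
  have hm : Measurable (queueEntrance τ ν a b) := h.queueEntrance_mono.measurable
  have haem : ∀ {g : ℝ → ℝ} (s : Set ℝ), IsRate g → AEMeasurable (fun x => g x)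
      (volume.restrict s) := fun s hg =>
    hg.locallyIntegrable.aestronglyMeasurable.aemeasurable.restrict
  set r : ℝ → ENNReal := fun x => ENNReal.ofReal (aj x / a x) with hr
  have hra : ∀ s, AEMeasurable r (volume.restrict s) := fun s =>
    ((haem s haj).div (haem s h.inflow)).ennreal_ofReal
  have h1 : ∫⁻ x in Set.Iic (queueExit τ ν a b ξ), ENNReal.ofReal (bj x) =
      ∫⁻ x in Set.Iic ξ, ENNReal.ofReal (aj x) := by
    -- With the share `r = aj / a` and the entrance time `ϑ`, the FIFO law reads `bj = b * r ∘ ϑ`.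
    -- Integrating `r ∘ ϑ` against the outflow measure is integrating `r` against its pushforward,
    -- the inflow measure, and `r * a = aj`.
    calc ∫⁻ x in Set.Iic (queueExit τ ν a b ξ), ENNReal.ofReal (bj x)
        = ∫⁻ x in Set.Iic (queueExit τ ν a b ξ),
            ((fun x => ENNReal.ofReal (b x)) * fun x => r (queueEntrance τ ν a b x)) x := by
          refine lintegral_congr_ae (ae_restrict_of_ae ?_)
          filter_upwards [hfifo] with x hx
          rcases lt_or_ge x 0 with hx0 | hx0
          · simp [hbj.neg x hx0, h.outflow.neg x hx0]
          · simp only [Pi.mul_apply, hr]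
            rw [hx hx0, ← ENNReal.ofReal_mul (h.outflow.nonneg x)]
            split_ifs with hp
            · rfl
            -- Division by zero makes the share vanish where there is no inflow, in agreement with
            -- the `else` case of the law.
            · rw [le_antisymm (not_lt.1 hp) (h.inflow.nonneg _)]
              simp
      _ = ∫⁻ x, r (queueEntrance τ ν a b x) ∂((volume.restrict
            (Set.Iic (queueExit τ ν a b ξ))).withDensity (fun x => ENNReal.ofReal (b x))) := by
          rw [lintegral_withDensity_eq_lintegral_mul₀' (haem _ h.outflow).ennreal_ofReal]
          refine AEMeasurable.comp_measurable (g := r) ?_ hm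
          rw [h.map_queueEntrance ξ]
          exact (hra _).mono_ac (withDensity_absolutelyContinuous _ _)
      _ = ∫⁻ x, r x ∂((volume.restrict (Set.Iic ξ)).withDensity
            (fun x => ENNReal.ofReal (a x))) := by
          rw [← h.map_queueEntrance ξ, lintegral_map' _ hm.aemeasurable]
          rw [h.map_queueEntrance ξ]
          exact (hra _).mono_ac (withDensity_absolutelyContinuous _ _)
      _ = ∫⁻ x in Set.Iic ξ, ENNReal.ofReal (aj x) := by
          rw [lintegral_withDensity_eq_lintegral_mul₀ (haem _ h.inflow).ennreal_ofReal (hra _)]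
          refine lintegral_congr fun x => ?_
          simp only [Pi.mul_apply, hr]
          rw [← ENNReal.ofReal_mul (h.inflow.nonneg x)]
          congr 1
          rcases (h.inflow.nonneg x).eq_or_lt with h0 | h0
          · rw [← h0, zero_mul]
            exact (le_antisymm ((hle x).trans h0.ge) (haj.nonneg x)).symm
          · field_simp
  rw [haj.lintegral_Iic, hbj.lintegral_Iic] at h1
  exact (ENNReal.ofReal_eq_ofReal_iff (hbj.cumulative_nonneg _) (haj.cumulative_nonneg _)).1 h1

end IsQueueFlow

/-! ### The arcs of a feasible flow over time -/

namespace FlowRates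

variable {J V E : Type*} [Fintype J] [Fintype E] [DecidableEq V]
  {f : FlowRates J E} {N : Network V E} {C : J → Commodity N}

theorem IsFeasible.isRate_in (hf : f.IsFeasible N C) (j : J) (e : E) : IsRate (f.inRate j e) :=
  ⟨hf.in_nonneg j e, hf.in_bounded j e, hf.in_locallyIntegrable j e, hf.in_neg j e⟩

theorem IsFeasible.isRate_out (hf : f.IsFeasible N C) (j : J) (e : E) : IsRate (f.outRate j e) :=
  ⟨hf.out_nonneg j e, hf.out_bounded j e, hf.out_locallyIntegrable j e, hf.out_neg j e⟩

theorem IsFeasible.isRate_totalIn (hf : f.IsFeasible N C) (e : E) : IsRate (f.totalIn e) :=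
  IsRate.sum fun j => hf.isRate_in j e

theorem IsFeasible.isRate_totalOut (hf : f.IsFeasible N C) (e : E) : IsRate (f.totalOut e) :=
  IsRate.sum fun j => hf.isRate_out j e

theorem IsFeasible.cumulative_totalIn (hf : f.IsFeasible N C) (e : E) (θ : ℝ) :
    cumulative (f.totalIn e) θ = ∑ j, f.cumIn j e θ :=
  cumulative_sum (fun j => hf.isRate_in j e) θ

theorem IsFeasible.cumulative_totalOut (hf : f.IsFeasible N C) (e : E) (θ : ℝ) :
    cumulative (f.totalOut e) θ = ∑ j, f.cumOut j e θ :=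
  cumulative_sum (fun j => hf.isRate_out j e) θ

theorem IsFeasible.isQueueFlow (hf : f.IsFeasible N C) (e : E) :
    IsQueueFlow (N.tau e) (N.nu e) (f.totalIn e) (f.totalOut e) where
  tau_pos := N.tau_pos e
  nu_pos := N.nu_pos e
  inflow := hf.isRate_totalIn e
  outflow := hf.isRate_totalOut e
  law := by
    filter_upwards [hf.outflow e] with θ hθ h0
    rw [hθ h0, hf.cumulative_totalIn, hf.cumulative_totalOut]
    rfl

theorem IsFeasible.exitTime_eq (hf : f.IsFeasible N C) (e : E) :
    f.exitTime N e = queueExit (N.tau e) (N.nu e) (f.totalIn e) (f.totalOut e) := by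
  ext ξ
  simp only [exitTime, waitingTime, queueSize, queueExit, add_sub_cancel_right,
    hf.cumulative_totalIn, hf.cumulative_totalOut]

theorem IsFeasible.cumOut_exitTime (hf : f.IsFeasible N C) (j : J) (e : E) (ξ : ℝ) :
    f.cumOut j e (f.exitTime N e ξ) = f.cumIn j e ξ := by
  rw [hf.exitTime_eq]
  refine (hf.isQueueFlow e).cumulative_part_queueExit (hf.isRate_in j e) (hf.isRate_out j e)
    (fun x => Finset.single_le_sum (f := fun j => f.inRate j e x)
      (fun i _ => hf.in_nonneg i e x) (Finset.mem_univ j)) ?_ ξ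
  filter_upwards [hf.fifo j e] with θ hθ h0
  have he : f.entranceTime N e =
      queueEntrance (N.tau e) (N.nu e) (f.totalIn e) (f.totalOut e) := by
    ext θ
    simp only [entranceTime, hf.exitTime_eq e]
    rfl
  rw [hθ h0, he]

end FlowRates

/-! ### Counting packets -/

open Classical in
/-- The number of packets of commodity `j` in a list. -/
noncomputable def packetCount {J : Type*} (j : J) (L : List (J × ℕ)) : ℕ :=
  L.countP (fun p => p.1 = j)

@[simp] theorem packetCount_nil {J : Type*} (j : J) : packetCount j [] = 0 := rfl

@[simp] theorem packetCount_append {J : Type*} (j : J) (L M : List (J × ℕ)) :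
    packetCount j (L ++ M) = packetCount j L + packetCount j M := List.countP_append

theorem packetCount_le_length {J : Type*} (j : J) (L : List (J × ℕ)) :
    packetCount j L ≤ L.length := List.countP_le_length

theorem sum_packetCount {J : Type*} [Fintype J] (L : List (J × ℕ)) :
    ∑ j, packetCount j L = L.length := by
  classical
  induction L with
  | nil => simp
  | cons p L ih =>
    simp only [packetCount, List.countP_cons, Finset.sum_add_distrib, List.length_cons] at ih ⊢
    rw [ih]
    simp

/-- Two prefixes of a list differ in the number of packets of a commodity by at most the difference
of their lengths. -/
theorem packetCount_take_le {J : Type*} (j : J) (L : List (J × ℕ)) (m n : ℕ) :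
    packetCount j (L.take n) ≤ packetCount j (L.take m) + (n - m) := by
  rcases le_total n m with h | h
  · have : L.take m = L.take n ++ (L.drop n).take (m - n) := by
      rw [← List.take_add, Nat.add_sub_cancel' h]
    rw [this, packetCount_append]
    omega
  · have : L.take n = L.take m ++ (L.drop m).take (n - m) := by
      rw [← List.take_add, Nat.add_sub_cancel' h]
    rw [this, packetCount_append]
    have h1 := packetCount_le_length j ((L.drop m).take (n - m))
    have h2 := List.length_take_le (n - m) (L.drop m)
    omega

/-- Each step of the merging moves one packet from a line to the result, so counts are preserved.
The counters play no role, and nothing else about the order of merging is needed. -/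
theorem ZipperRun.countP_eq {ι P : Type*} [DecidableEq ι] [Fintype ι] {y : ι → ℕ}
    {Y : ι → List P} {a : ι → ℚ} {L : List P} (h : ZipperRun y Y a L) (q : P → Bool) :
    L.countP q = ∑ i, (Y i).countP q := by
  induction h with
  | done Y a h => simp [h]
  | step Y a i p rest L hp hmin hL ih =>
    rw [List.countP_cons, ih, ← Finset.add_sum_erase _ _ (Finset.mem_univ i),
      ← Finset.add_sum_erase Finset.univ (fun i => (Y i).countP q) (Finset.mem_univ i)]
    have h1 : ∑ x ∈ Finset.univ.erase i, (Function.update Y i rest x).countP q =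
        ∑ x ∈ Finset.univ.erase i, (Y x).countP q :=
      Finset.sum_congr rfl fun x hx => by
        rw [Function.update_of_ne (Finset.ne_of_mem_erase hx)]
    simp only [h1, Function.update_self, hp, List.countP_cons]
    omega

/-! ### The line of an arc as a segment of the sequence of entering packets -/

namespace Loading

variable {J V E : Type*} (X : Loading J V E) (N : Network V E) (α : ℝ)

/-- All packets that enter `e` before time step `t`, in this order, with their entrance time
steps. -/
def entered (e : E) : ℕ → List ((J × ℕ) × ℕ)
  | 0 => []
  | t + 1 => entered e t ++ (X.entering t e).map (fun p => (p, t))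

/-- The number of packets that leave `e` before time step `t`. -/
noncomputable def numLeft (e : E) (t : ℕ) : ℕ := ∑ s ∈ Finset.range t, (X.leaving N α s e).length

/-- The number of packets that enter `e` before time step `t`. -/
def numEntered (e : E) (t : ℕ) : ℕ := ∑ s ∈ Finset.range t, (X.entering s e).length

/-- The number of packets of commodity `j` that enter `e` before time step `t`. -/
noncomputable def inCount (j : J) (e : E) (t : ℕ) : ℕ :=
  ∑ s ∈ Finset.range t, packetCount j (X.entering s e)

/-- The number of packets of commodity `j` that leave `e` before time step `t`. -/
noncomputable def outCount (j : J) (e : E) (t : ℕ) : ℕ :=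
  ∑ s ∈ Finset.range t, packetCount j (X.leaving N α s e)

theorem numEntered_mono (e : E) : Monotone (X.numEntered e) :=
  monotone_nat_of_le_succ fun t => by simp [numEntered, Finset.sum_range_succ]

theorem numLeft_mono (e : E) : Monotone (X.numLeft N α e) :=
  monotone_nat_of_le_succ fun t => by simp [numLeft, Finset.sum_range_succ]

theorem numEntered_eq_sum [Fintype J] (e : E) (t : ℕ) :
    X.numEntered e t = ∑ j, X.inCount j e t := by
  simp only [numEntered, inCount]
  rw [Finset.sum_comm]
  simp only [sum_packetCount]

theorem numLeft_eq_sum [Fintype J] (e : E) (t : ℕ) :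
    X.numLeft N α e t = ∑ j, X.outCount N α j e t := by
  simp only [numLeft, outCount]
  rw [Finset.sum_comm]
  simp only [sum_packetCount]

theorem length_entered (e : E) (t : ℕ) : (X.entered e t).length = X.numEntered e t := by
  induction t with
  | zero => rfl
  | succ t ih => simp [entered, numEntered, Finset.sum_range_succ, ih]

theorem packetCount_entered (j : J) (e : E) (t : ℕ) :
    packetCount j ((X.entered e t).map Prod.fst) = X.inCount j e t := by
  induction t with
  | zero => rfl
  | succ t ih => simp [entered, inCount, Finset.sum_range_succ, ih, Function.comp_def]

theorem lt_of_mem_entered {e : E} {t : ℕ} {q : (J × ℕ) × ℕ} (hq : q ∈ X.entered e t) :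
    q.2 < t := by
  induction t with
  | zero => simp [entered] at hq
  | succ t ih =>
    simp only [entered, List.mem_append, List.mem_map] at hq
    rcases hq with hq | ⟨p, -, rfl⟩
    · exact (ih hq).trans (Nat.lt_succ_self t)
    · exact Nat.lt_succ_self t

theorem exists_entered_eq_append (e : E) {s t : ℕ} (hst : s ≤ t) :
    ∃ R, X.entered e t = X.entered e s ++ R ∧ ∀ q ∈ R, s ≤ q.2 := by
  induction t, hst using Nat.le_induction with
  | base => exact ⟨[], by simp, by simp⟩
  | succ t hst ih =>
    obtain ⟨R, hR, hq⟩ := ih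
    refine ⟨R ++ (X.entering t e).map (fun p => (p, t)), by simp [entered, hR], ?_⟩
    intro q hq'
    simp only [List.mem_append, List.mem_map] at hq'
    rcases hq' with hq' | ⟨p, -, rfl⟩
    · exact hq q hq'
    · exact hst

theorem take_entered (e : E) {s t : ℕ} (hst : s ≤ t) :
    (X.entered e t).take (X.numEntered e s) = X.entered e s := by
  obtain ⟨R, hR, -⟩ := X.exists_entered_eq_append e hst
  rw [hR, ← X.length_entered]
  simp

/-- The number of time steps that a packet spends at least on `e`. -/
noncomputable def delay (e : E) : ℕ := ⌈N.tau e / α⌉₊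

/-- Entrance steps do not decrease along the line, so the condition defining the buffer cuts it
exactly where the packets with entrance step `t + 1 - delay` or later begin. Truncated subtraction
gives the empty buffer while `t < delay`. -/
theorem buffer_eq_of_queue_eq {α : ℝ} (hα : 0 < α) {e : E} {t : ℕ}
    (hq : X.queue t e = (X.entered e t).drop (X.numLeft N α e t))
    (hle : X.numLeft N α e t ≤ X.numEntered e (t - delay N α e)) :
    X.buffer N α t e =
      (X.entered e (t + 1 - delay N α e)).drop (X.numLeft N α e t) := by
  have hc : 0 < delay N α e := Nat.ceil_pos.2 (div_pos (N.tau_pos e) hα)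
  obtain ⟨R, hR, hRm⟩ := X.exists_entered_eq_append e (s := t + 1 - delay N α e) (t := t) (by omega)
  have hle' : X.numLeft N α e t ≤ (X.entered e (t + 1 - delay N α e)).length := by
    rw [length_entered]
    exact hle.trans (X.numEntered_mono e (by omega))
  unfold buffer
  rw [hq, hR, List.drop_append_of_le_length hle', List.takeWhile_append_of_pos]
  · have : R.takeWhile (fun q => q.2 + ⌈N.tau e / α⌉₊ ≤ t) = [] := by
      rcases R with - | ⟨q, R⟩
      · rfl
      · have := hRm q (by simp)
        rw [List.takeWhile_cons_of_neg]
        change ¬ decide (q.2 + delay N α e ≤ t) = true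
        simp
        omega
    rw [this, List.append_nil]
  · intro q hqm
    have h1 := X.lt_of_mem_entered (List.mem_of_mem_drop hqm)
    change decide (q.2 + delay N α e ≤ t) = true
    simp
    omega

theorem numLeft_succ (e : E) (t : ℕ) : X.numLeft N α e (t + 1) =
    X.numLeft N α e t + min ⌊X.cap t e⌋₊ (X.buffer N α t e).length := by
  simp [numLeft, Finset.sum_range_succ, leaving]

namespace IsNetworkLoading

variable {X N α} {C : J → Commodity N} {β : ℝ} [DecidableEq E]
  (h : X.IsNetworkLoading N C α β) (hα : 0 < α)
include h hα

/-- The two parts are proved together: describing the buffer needs the bound on departures, and the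
bound persists because departures are taken from the buffer. -/
theorem queue_eq (e : E) (t : ℕ) :
    X.queue t e = (X.entered e t).drop (X.numLeft N α e t) ∧
      X.numLeft N α e t ≤ X.numEntered e (t - delay N α e) := by
  have hc : 0 < delay N α e := Nat.ceil_pos.2 (div_pos (N.tau_pos e) hα)
  induction t with
  | zero => simp [h.queue_zero, entered, numLeft]
  | succ t ih =>
    have hb := X.buffer_eq_of_queue_eq N hα ih.1 ih.2
    have hl : (X.leaving N α t e).length ≤
        X.numEntered e (t + 1 - delay N α e) - X.numLeft N α e t := by
      unfold leaving
      rw [hb]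
      simp [length_entered]
    have hs : X.numLeft N α e (t + 1) = X.numLeft N α e t + (X.leaving N α t e).length := by
      simp [numLeft, Finset.sum_range_succ]
    have hm := X.numEntered_mono e (show t - delay N α e ≤ t + 1 - delay N α e by omega)
    have hm2 := X.numEntered_mono e (show t + 1 - delay N α e ≤ t by omega)
    have := ih.2
    refine ⟨?_, by omega⟩
    rw [h.queue_succ, ih.1, List.drop_drop, hs, entered, List.drop_append_of_le_length]
    rw [length_entered]
    omega

theorem numLeft_le (e : E) (t : ℕ) : X.numLeft N α e t ≤ X.numEntered e (t - delay N α e) :=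
  (h.queue_eq hα e t).2

theorem buffer_eq (e : E) (t : ℕ) : X.buffer N α t e =
    (X.entered e (t + 1 - delay N α e)).drop (X.numLeft N α e t) :=
  X.buffer_eq_of_queue_eq N hα (h.queue_eq hα e t).1 (h.queue_eq hα e t).2

theorem length_buffer (e : E) (t : ℕ) : (X.buffer N α t e).length =
    X.numEntered e (t + 1 - delay N α e) - X.numLeft N α e t := by
  rw [h.buffer_eq hα, List.length_drop, length_entered]

/-- The discrete first-in-first-out principle: the packets that have left are an initial segment of
those that have entered. -/
theorem packetCount_take_entered (j : J) (e : E) (t : ℕ) :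
    packetCount j (((X.entered e t).map Prod.fst).take (X.numLeft N α e t)) =
      X.outCount N α j e t := by
  have hc : 0 < delay N α e := Nat.ceil_pos.2 (div_pos (N.tau_pos e) hα)
  induction t with
  | zero => simp [entered, outCount]
  | succ t ih =>
    have hl : (X.leaving N α t e).length = min ⌊X.cap t e⌋₊ (X.buffer N α t e).length := by
      simp [leaving]
    have h1 : X.leaving N α t e = (((X.entered e (t + 1)).map Prod.fst).drop
        (X.numLeft N α e t)).take (X.leaving N α t e).length := by
      obtain ⟨R, hR, -⟩ := X.exists_entered_eq_append e
        (s := t + 1 - delay N α e) (t := t + 1) (by omega)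
      have hle : X.numLeft N α e t ≤ (X.entered e (t + 1 - delay N α e)).length := by
        rw [length_entered]
        exact (h.numLeft_le hα e t).trans (X.numEntered_mono e (by omega))
      rw [hl, hR, ← List.map_drop, List.drop_append_of_le_length hle, ← h.buffer_eq hα, leaving,
        ← List.map_take, List.take_append_of_le_length (min_le_right _ _), List.take_eq_take_min]
    have h2 : X.numLeft N α e (t + 1) = X.numLeft N α e t + (X.leaving N α t e).length := by
      simp [numLeft, Finset.sum_range_succ]
    have h3 : ((X.entered e (t + 1)).map Prod.fst).take (X.numLeft N α e t) =
        ((X.entered e t).map Prod.fst).take (X.numLeft N α e t) := by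
      rw [entered, List.map_append, List.take_append_of_le_length]
      rw [List.length_map, length_entered]
      exact (h.numLeft_le hα e t).trans (X.numEntered_mono e (by omega))
    rw [h2, List.take_add, packetCount_append, ← h1, h3, ih, outCount, outCount,
      Finset.sum_range_succ]

theorem outCount_le_add (j : J) (e : E) (s t : ℕ) :
    X.outCount N α j e t ≤ X.inCount j e s + (X.numLeft N α e t - X.numEntered e s) := by
  obtain ⟨R, hR, -⟩ := X.exists_entered_eq_append e (le_max_left t s)
  -- Both counts are taken over prefixes of the sequence of packets entered before step `max t s`.
  rw [← h.packetCount_take_entered hα, ← X.packetCount_entered,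
    ← X.take_entered e (le_max_right t s)]
  have h1 : ((X.entered e t).map Prod.fst).take (X.numLeft N α e t) =
      ((X.entered e (max t s)).map Prod.fst).take (X.numLeft N α e t) := by
    rw [hR, List.map_append, List.take_append_of_le_length]
    rw [List.length_map, length_entered]
    exact (h.numLeft_le hα e t).trans (X.numEntered_mono e (by omega))
  rw [h1, List.map_take]
  exact packetCount_take_le _ _ _ _

theorem inCount_le_add (j : J) (e : E) (s t : ℕ) :
    X.inCount j e s ≤ X.outCount N α j e t + (X.numEntered e s - X.numLeft N α e t) := by
  obtain ⟨R, hR, -⟩ := X.exists_entered_eq_append e (le_max_left t s)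
  rw [← h.packetCount_take_entered hα, ← X.packetCount_entered,
    ← X.take_entered e (le_max_right t s)]
  have h1 : ((X.entered e t).map Prod.fst).take (X.numLeft N α e t) =
      ((X.entered e (max t s)).map Prod.fst).take (X.numLeft N α e t) := by
    rw [hR, List.map_append, List.take_append_of_le_length]
    rw [List.length_map, length_entered]
    exact (h.numLeft_le hα e t).trans (X.numEntered_mono e (by omega))
  rw [h1, List.map_take]
  exact packetCount_take_le _ _ _ _

/-- First in first out, quantitatively. -/
theorem abs_outCount_sub_inCount_le (j : J) (e : E) (s t : ℕ) :
    |(X.outCount N α j e t : ℝ) - X.inCount j e s| ≤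
      |(X.numLeft N α e t : ℝ) - X.numEntered e s| := by
  have h1 := h.outCount_le_add hα j e s t
  have h2 := h.inCount_le_add hα j e s t
  rcases le_total (X.numLeft N α e t) (X.numEntered e s) with hle | hle
  · rw [Nat.sub_eq_zero_of_le hle, add_zero] at h1
    have h2' : X.inCount j e s + X.numLeft N α e t ≤
      X.outCount N α j e t + X.numEntered e s := by omega
    rw [abs_of_nonpos (by simpa using h1), abs_of_nonpos (by simpa using hle)]
    have : (X.inCount j e s : ℝ) + X.numLeft N α e t ≤
      X.outCount N α j e t + X.numEntered e s := by exact_mod_cast h2'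
    linarith
  · rw [Nat.sub_eq_zero_of_le hle, add_zero] at h2
    have h1' : X.outCount N α j e t + X.numEntered e s ≤
      X.inCount j e s + X.numLeft N α e t := by omega
    rw [abs_of_nonneg (by simpa using h2), abs_of_nonneg (by simpa using hle)]
    have : (X.outCount N α j e t : ℝ) + X.numEntered e s ≤
      X.inCount j e s + X.numLeft N α e t := by exact_mod_cast h1'
    linarith

theorem inCount_le_outCount {e : E} {s t : ℕ} (hle : X.numEntered e s ≤ X.numLeft N α e t)
    (j : J) : X.inCount j e s ≤ X.outCount N α j e t := by
  have := h.inCount_le_add hα j e s t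
  omega

end IsNetworkLoading

/-! ### Throughput of an arc in the packet model -/

namespace IsNetworkLoading

variable {X N α} {C : J → Commodity N} {β : ℝ} [DecidableEq E]
  (h : X.IsNetworkLoading N C α β) (hα : 0 < α) (hβ : 0 < β)
include h

theorem le_cap (e : E) (t : ℕ) : N.nu e * α / β ≤ X.cap t e := by
  induction t with
  | zero => rw [h.cap_zero]
  | succ t ih =>
    rw [h.cap_succ]
    split_ifs
    · exact le_rfl
    · linarith [Int.floor_le (X.cap t e)]

theorem cap_le (e : E) (t : ℕ) : X.cap t e ≤ N.nu e * α / β + 1 := by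
  cases t with
  | zero => rw [h.cap_zero]; linarith
  | succ t =>
    rw [h.cap_succ]
    split_ifs
    · linarith
    · linarith [Int.lt_floor_add_one (X.cap t e)]

include hα hβ

theorem floor_cap_eq (e : E) (t : ℕ) : ((⌊X.cap t e⌋₊ : ℕ) : ℝ) = (⌊X.cap t e⌋ : ℤ) := by
  have : 0 ≤ X.cap t e := le_trans (by have := (N.nu_pos e).le; positivity) (h.le_cap e t)
  rw [← natCast_floor_eq_intCast_floor this]

/-- Departures plus current capacity serve as a potential: the rounding loss of a step reappears in
the next capacity, so the potential grows by at most the nominal capacity per step. As the capacity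
stays within one of its nominal value, rounding errors do not accumulate. -/
theorem numLeft_succ_le (e : E) (t : ℕ) : (X.numLeft N α e (t + 1) : ℝ) + X.cap (t + 1) e ≤
    X.numLeft N α e t + X.cap t e + N.nu e * α / β := by
  have h1 : (X.numLeft N α e (t + 1) : ℝ) ≤ X.numLeft N α e t + ⌊X.cap t e⌋₊ := by
    rw [X.numLeft_succ N α]
    push_cast
    linarith [min_le_left ((⌊X.cap t e⌋₊ : ℕ) : ℝ) ((X.buffer N α t e).length : ℝ)]
  rw [h.floor_cap_eq hα hβ] at h1
  rw [h.cap_succ]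
  split_ifs
  · linarith [Int.floor_le (X.cap t e)]
  · linarith

theorem numLeft_sub_le (e : E) {s t : ℕ} (hst : s ≤ t) : (X.numLeft N α e t : ℝ) ≤
    X.numLeft N α e s + N.nu e * α / β * (t - s) + 1 := by
  have key : (X.numLeft N α e t : ℝ) + X.cap t e ≤
      X.numLeft N α e s + X.cap s e + N.nu e * α / β * (t - s) := by
    induction t, hst using Nat.le_induction with
    | base => simp
    | succ t hst ih =>
      have := h.numLeft_succ_le hα hβ e t
      push_cast
      linarith
  linarith [h.cap_le e s, h.le_cap e t]

/-- Discrete counterpart of `IsQueueFlow.cumulative_out_le_add`. -/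
theorem numLeft_le_add (e : E) {s t : ℕ} (hst : s ≤ t) : (X.numLeft N α e t : ℝ) ≤
    X.numEntered e (s - delay N α e) + N.nu e * α / β * (t - s) + 1 := by
  have h1 := h.numLeft_sub_le hα hβ e hst
  have h2 : (X.numLeft N α e s : ℝ) ≤ X.numEntered e (s - delay N α e) := by
    exact_mod_cast h.numLeft_le hα e s
  linarith

/-- In each time step the buffer is emptied or the capacity is used up. -/
theorem numLeft_succ_cases (e : E) (t : ℕ) :
    (X.numLeft N α e (t + 1) = X.numEntered e (t + 1 - delay N α e) ∧
      X.cap (t + 1) e = N.nu e * α / β) ∨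
    (X.numLeft N α e (t + 1) : ℝ) + X.cap (t + 1) e =
      X.numLeft N α e t + X.cap t e + N.nu e * α / β := by
  have hs := X.numLeft_succ N α e t
  have hc := h.cap_succ t e
  by_cases hb : ((X.buffer N α t e).length : ℝ) ≤ X.cap t e
  · left
    rw [if_pos hb] at hc
    refine ⟨?_, hc⟩
    rw [hs, min_eq_right (Nat.le_floor hb), h.length_buffer hα]
    have := (h.numLeft_le hα e t).trans
      (X.numEntered_mono e (show t - delay N α e ≤ t + 1 - delay N α e by omega))
    omega
  · right
    rw [if_neg hb] at hc
    have h1 : ⌊X.cap t e⌋₊ ≤ (X.buffer N α t e).length :=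
      Nat.floor_le_of_le (not_le.1 hb).le
    rw [min_eq_left h1] at hs
    rw [hs, hc]
    push_cast
    rw [h.floor_cap_eq hα hβ]
    ring

/-- Discrete counterpart of `IsQueueFlow.exists_cumulative_out_eq`: the witness `s` follows the last
step that emptied the buffer, or is `0` if there was none. -/
theorem exists_numLeft_ge (e : E) (t : ℕ) : ∃ s ≤ t,
    (X.numEntered e (s - delay N α e) : ℝ) + N.nu e * α / β * (t - s) - 1 ≤
      X.numLeft N α e t := by
  have key : ∃ s ≤ t, (X.numEntered e (s - delay N α e) : ℝ) + N.nu e * α / β * (t - s) +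
      N.nu e * α / β ≤ X.numLeft N α e t + X.cap t e := by
    induction t with
    | zero => exact ⟨0, le_rfl, by simp [numEntered, numLeft, h.cap_zero]⟩
    | succ t ih =>
      rcases h.numLeft_succ_cases hα hβ e t with ⟨h1, h2⟩ | h1
      · exact ⟨t + 1, le_rfl, by rw [h1, h2]; simp⟩
      · obtain ⟨s, hs, hle⟩ := ih
        refine ⟨s, by omega, ?_⟩
        rw [h1]
        push_cast
        linarith
  obtain ⟨s, hs, hle⟩ := key
  exact ⟨s, hs, by linarith [h.cap_le e t]⟩

/-- Either some step from `s` on empties the buffer, and then everything available at step `s` has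
left, or the arc is busy throughout and the potential grows at full rate. -/
theorem numLeft_ge_or (e : E) {s t : ℕ} (hst : s ≤ t) :
    X.numEntered e (s + 1 - delay N α e) ≤ X.numLeft N α e t ∨
      (X.numLeft N α e s : ℝ) + N.nu e * α / β * (t - s) - 1 ≤ X.numLeft N α e t := by
  have key : X.numEntered e (s + 1 - delay N α e) ≤ X.numLeft N α e t ∨
      (X.numLeft N α e s : ℝ) + X.cap s e + N.nu e * α / β * (t - s) ≤
        X.numLeft N α e t + X.cap t e := by
    induction t, hst using Nat.le_induction with
    | base => right; simp
    | succ t hst ih =>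
      rcases ih with ih | ih
      · exact Or.inl (ih.trans (X.numLeft_mono N α e (Nat.le_succ t)))
      · rcases h.numLeft_succ_cases hα hβ e t with ⟨h1, h2⟩ | h1
        · left
          rw [h1]
          exact X.numEntered_mono e (by omega)
        · right
          rw [h1]
          push_cast
          linarith
  rcases key with key | key
  · exact Or.inl key
  · right
    linarith [h.cap_le e t, h.le_cap e s]

/-- All packets that enter an arc leave it eventually. -/
theorem exists_numEntered_le_numLeft (e : E) (s : ℕ) :
    ∃ t, X.numEntered e s ≤ X.numLeft N α e t := by
  by_contra! hlt
  have hpos : 0 < N.nu e * α / β := by have := N.nu_pos e; positivity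
  -- In `n` busy steps more packets would leave than have entered before step `s`; the `+ 1` covers
  -- the rounding error.
  obtain ⟨n, hn⟩ := exists_nat_gt ((X.numEntered e s + 1 : ℝ) / (N.nu e * α / β))
  rw [div_lt_iff₀ hpos] at hn
  rcases h.numLeft_ge_or hα hβ e (Nat.le_add_right (s + delay N α e) n) with h1 | h1
  · have h2 := X.numEntered_mono e
      (show s ≤ s + delay N α e + 1 - delay N α e by omega)
    have := hlt (s + delay N α e + n)
    omega
  · have h2 : (X.numLeft N α e (s + delay N α e + n) : ℝ) < X.numEntered e s := by
      exact_mod_cast hlt _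
    have h3 : (0 : ℝ) ≤ X.numLeft N α e (s + delay N α e) := Nat.cast_nonneg _
    push_cast at h1
    nlinarith

end IsNetworkLoading

end Loading

/-! ### Simple paths -/

namespace Network.IsSimplePath

variable {V E : Type*} {N : Network V E} {o d : V} {p : List E} (hp : N.IsSimplePath o d p)
include hp

theorem length_pos : 0 < p.length := by
  rcases p with - | ⟨e, p⟩
  · have := hp.starts
    simp at this
  · simp

theorem src_zero : N.src (p[0]'hp.length_pos) = o := by
  have h := hp.starts
  have h1 := hp.length_pos
  rw [List.head?_eq_getElem?, List.getElem?_eq_getElem h1] at h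
  simpa using h

theorem tgt_last : N.tgt (p[p.length - 1]'(Nat.sub_lt hp.length_pos one_pos)) = d := by
  have h := hp.ends
  have h1 := hp.length_pos
  rw [List.getLast?_eq_getElem?, List.getElem?_eq_getElem (by omega)] at h
  simpa using h

theorem tgt_eq_src {k : ℕ} (hk : k + 1 < p.length) : N.tgt p[k] = N.src p[k + 1] :=
  (List.isChain_iff_getElem.1 hp.chain) k hk

theorem length_pathNodes : (N.pathNodes p).length = p.length + 1 := by
  rcases p with - | ⟨e, p⟩
  · exact absurd hp.length_pos (by simp)
  · simp [pathNodes]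

theorem pathNodes_succ {k : ℕ} (hk : k < p.length) :
    (N.pathNodes p)[k + 1]'(by rw [hp.length_pathNodes]; omega) = N.tgt p[k] := by
  rcases p with - | ⟨e, p⟩
  · exact absurd hp.length_pos (by simp)
  · simp only [pathNodes, List.getElem_cons_succ, List.getElem_map]

theorem pathNodes_of_lt {k : ℕ} (hk : k < p.length) :
    (N.pathNodes p)[k]'(by rw [hp.length_pathNodes]; omega) = N.src p[k] := by
  cases k with
  | zero =>
    rcases p with - | ⟨e, p⟩
    · exact absurd hp.length_pos (by simp)
    · simp [pathNodes]
  | succ k => rw [hp.pathNodes_succ (by omega), hp.tgt_eq_src hk]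

theorem src_injective {i k : ℕ} (hi : i < p.length) (hk : k < p.length)
    (h : N.src p[i] = N.src p[k]) : i = k := by
  rw [← hp.pathNodes_of_lt hi, ← hp.pathNodes_of_lt hk] at h
  exact (hp.simple.getElem_inj_iff).1 h

theorem eq_succ_of_tgt_eq_src {i k : ℕ} (hi : i < p.length) (hk : k < p.length)
    (h : N.tgt p[i] = N.src p[k]) : k = i + 1 := by
  rw [← hp.pathNodes_succ hi, ← hp.pathNodes_of_lt hk] at h
  exact ((hp.simple.getElem_inj_iff).1 h).symm

theorem src_ne_dest {k : ℕ} (hk : k < p.length) : N.src p[k] ≠ d := by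
  intro h
  have h1 := hp.length_pos
  have := hp.eq_succ_of_tgt_eq_src (i := p.length - 1) (by omega) hk (hp.tgt_last.trans h.symm)
  omega

theorem nodup : p.Nodup := by
  refine List.nodup_iff_injective_get.2 fun i k hik => ?_
  exact Fin.ext (hp.src_injective i.2 k.2 (congrArg N.src hik))

theorem pair_infix_iff {k : ℕ} (hk : k + 1 < p.length) (e : E) :
    [e, p[k + 1]] <:+: p ↔ e = p[k] := by
  constructor
  · rintro ⟨s, t, hst⟩
    have hlen := congrArg List.length hst
    simp only [List.length_append, List.length_cons, List.length_nil] at hlen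
    have h1 : p[s.length]? = some e := by
      conv_lhs => rw [← hst]
      simp
    have h2 : p[s.length + 1]? = some p[k + 1] := by
      conv_lhs => rw [← hst]
      simp
    rw [List.getElem?_eq_getElem (by omega), Option.some_inj] at h1 h2
    have h3 : s.length + 1 = k + 1 := (hp.nodup.getElem_inj_iff).1 h2
    have h4 : s.length = k := by omega
    subst h4
    exact h1.symm
  · rintro rfl
    refine ⟨p.take k, p.drop (k + 2), ?_⟩
    have : p.drop k = p[k] :: p[k + 1] :: p.drop (k + 2) := by
      rw [List.drop_eq_getElem_cons (by omega), List.drop_eq_getElem_cons (i := k + 1) hk]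
    conv_rhs => rw [← List.take_append_drop k p, this]
    simp

theorem not_pair_infix_zero (e : E) : ¬ [e, p[0]'hp.length_pos] <:+: p := by
  rintro ⟨s, t, hst⟩
  have h1 := hp.length_pos
  have hlen := congrArg List.length hst
  simp only [List.length_append, List.length_cons, List.length_nil] at hlen
  have h2 : p[s.length + 1]? = some p[0] := by
    conv_lhs => rw [← hst]
    simp
  rw [List.getElem?_eq_getElem (by omega), Option.some_inj] at h2
  have h3 : s.length + 1 = 0 := (hp.nodup.getElem_inj_iff).1 h2
  omega

end Network.IsSimplePath

/-! ### Supply -/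

namespace Commodity

variable {V E : Type*} {N : Network V E} (c : Commodity N)

/-- The supply rate, continued by zero to negative times. -/
noncomputable def rate : ℝ → ℝ := Set.indicator (Set.Ici 0) c.supply

theorem isRate_rate : IsRate c.rate where
  nonneg θ := Set.indicator_nonneg (fun x hx => c.supply_nonneg x hx) θ
  bounded := by
    obtain ⟨B, hB⟩ := c.supply_bounded
    refine ⟨max B 0, fun θ => ?_⟩
    unfold rate
    by_cases h : θ ∈ Set.Ici (0 : ℝ)
    · rw [Set.indicator_of_mem h]
      exact (hB θ h).trans (le_max_left _ _)
    · rw [Set.indicator_of_notMem h]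
      exact le_max_right _ _
  locallyIntegrable := (c.supply_integrable.integrable_indicator measurableSet_Ici).locallyIntegrable
  neg θ hθ := Set.indicator_of_notMem (by simpa using hθ) _

theorem integral_supply {θ : ℝ} (hθ : 0 ≤ θ) :
    ∫ ξ in (0 : ℝ)..θ, c.supply ξ = cumulative c.rate θ := by
  refine intervalIntegral.integral_congr fun x hx => ?_
  rw [Set.uIcc_of_le hθ] at hx
  simp only [rate]
  rw [Set.indicator_of_mem (show x ∈ Set.Ici (0 : ℝ) from hx.1)]

theorem cumulative_rate_le_mass (θ : ℝ) : cumulative c.rate θ ≤ c.mass := by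
  rcases le_total θ 0 with h | h
  · rw [c.isRate_rate.cumulative_of_nonpos h]
    exact setIntegral_nonneg measurableSet_Ici c.supply_nonneg
  · rw [← c.integral_supply h, intervalIntegral.integral_of_le h]
    refine setIntegral_mono_set c.supply_integrable ?_
      (Eventually.of_forall fun x hx => hx.1.le)
    exact (ae_restrict_iff' measurableSet_Ici).2 (Eventually.of_forall c.supply_nonneg)

theorem exists_cumulative_rate_eq_mass : ∃ H, 0 ≤ H ∧ ∀ θ, H ≤ θ → cumulative c.rate θ = c.mass := by
  obtain ⟨H, hH⟩ := c.supply_support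
  refine ⟨max H 0, le_max_right _ _, fun θ hθ => ?_⟩
  have h0 : 0 ≤ θ := (le_max_right _ _).trans hθ
  rw [← c.integral_supply h0, intervalIntegral.integral_of_le h0, mass,
    integral_Ici_eq_integral_Ioi]
  refine (setIntegral_eq_of_subset_of_forall_sdiff_eq_zero measurableSet_Ioi
    (fun x hx => hx.1) fun x hx => hH x ?_).symm
  have : θ < x := by
    by_contra! hc
    exact hx.2 ⟨hx.1, hc⟩
  exact ((le_max_left _ _).trans hθ).trans_lt this

theorem isLeast_releaseTime {φ : ℝ} (hφ : φ ∈ Set.Icc 0 c.mass) :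
    IsLeast {θ : ℝ | 0 ≤ θ ∧ cumulative c.rate θ = φ} (c.releaseTime φ) := by
  have he : {θ : ℝ | 0 ≤ θ ∧ ∫ ξ in (0 : ℝ)..θ, c.supply ξ = φ} =
      {θ : ℝ | 0 ≤ θ ∧ cumulative c.rate θ = φ} := by
    ext θ
    exact and_congr_right fun h => by rw [c.integral_supply h]
  unfold releaseTime
  rw [he]
  have hcl : IsClosed {θ : ℝ | 0 ≤ θ ∧ cumulative c.rate θ = φ} :=
    (isClosed_le continuous_const continuous_id).inter
      (isClosed_eq c.isRate_rate.continuous_cumulative continuous_const)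
  refine hcl.isLeast_csInf ?_ ⟨0, fun θ hθ => hθ.1⟩
  obtain ⟨H, hH0, hH⟩ := c.exists_cumulative_rate_eq_mass
  obtain ⟨θ, hθ, hφθ⟩ := intermediate_value_Icc hH0
    c.isRate_rate.continuous_cumulative.continuousOn
    (show φ ∈ Set.Icc (cumulative c.rate 0) (cumulative c.rate H) by
      rw [hH H le_rfl, c.isRate_rate.cumulative_of_nonpos le_rfl]
      exact hφ)
  exact ⟨θ, hθ.1, hφθ⟩

variable {α β : ℝ} (hα : 0 < α) (hβ : 0 < β)
include hα hβ

theorem releaseStep_le_iff {i : ℕ} (hi : i ≤ c.numPackets β) (t : ℕ) :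
    c.releaseStep α β i ≤ t ↔ i * β ≤ cumulative c.rate (α * t) := by
  have hu : ∀ s : ℕ, ∫ ξ in (0 : ℝ)..(α * s), c.supply ξ = cumulative c.rate (α * s) :=
    fun s => c.integral_supply (by positivity)
  have hm : 0 ≤ c.mass := setIntegral_nonneg measurableSet_Ici c.supply_nonneg
  have hne : {t : ℕ | (i : ℝ) * β ≤ ∫ ξ in (0 : ℝ)..(α * t), c.supply ξ}.Nonempty := by
    obtain ⟨H, hH0, hH⟩ := c.exists_cumulative_rate_eq_mass
    obtain ⟨s, hs⟩ := exists_nat_ge (H / α)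
    refine ⟨s, ?_⟩
    simp only [Set.mem_ofPred_eq]
    rw [hu, hH _ (by rwa [div_le_iff₀' hα] at hs)]
    have := (Nat.le_floor_iff (div_nonneg hm hβ.le)).1 hi
    rwa [le_div_iff₀ hβ] at this
  constructor
  · intro hle
    have h1 := Nat.sInf_mem hne
    simp only [Set.mem_ofPred_eq] at h1
    rw [hu] at h1
    refine h1.trans (c.isRate_rate.cumulative_mono ?_)
    exact mul_le_mul_of_nonneg_left (by exact_mod_cast hle) hα.le
  · intro hle
    exact Nat.sInf_le (by simp only [Set.mem_ofPred_eq]; rw [hu]; exact hle)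

/-- Packet `i` is released by step `t` iff the supply up to `α t` is at least `i β`, so the released
packets are an initial segment of the numbering. -/
theorem card_released (t : ℕ) :
    ((Finset.Icc 1 (c.numPackets β)).filter (fun i => c.releaseStep α β i < t + 1)).card =
      ⌊cumulative c.rate (α * t) / β⌋₊ := by
  have h0 : 0 ≤ cumulative c.rate (α * t) / β :=
    div_nonneg (c.isRate_rate.cumulative_nonneg _) hβ.le
  have : (Finset.Icc 1 (c.numPackets β)).filter (fun i => c.releaseStep α β i < t + 1) =
      Finset.Icc 1 ⌊cumulative c.rate (α * t) / β⌋₊ := by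
    ext i
    simp only [Finset.mem_filter, Finset.mem_Icc, Nat.lt_succ_iff]
    rw [Nat.le_floor_iff h0, le_div_iff₀ hβ]
    constructor
    · rintro ⟨⟨h1, h2⟩, h3⟩
      exact ⟨h1, (c.releaseStep_le_iff hα hβ h2 t).1 h3⟩
    · rintro ⟨h1, h2⟩
      have h3 : i ≤ c.numPackets β := by
        refine Nat.le_floor ?_
        rw [le_div_iff₀ hβ]
        exact h2.trans (c.cumulative_rate_le_mass _)
      exact ⟨⟨h1, h3⟩, (c.releaseStep_le_iff hα hβ h3 t).2 h2⟩
  rw [this]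
  simp

end Commodity

/-! ### Conservation along the paths -/

namespace FlowRates

variable {J V E : Type*} [Fintype J] [Fintype E] [DecidableEq V]
  {f : FlowRates J E} {N : Network V E} {C : J → Commodity N}

theorem cumulative_congr {g g' : ℝ → ℝ} (hg : IsRate g) (hg' : IsRate g')
    (hgg : ∀ᵐ θ, 0 ≤ θ → g θ = g' θ) : cumulative g = cumulative g' := by
  ext θ
  refine intervalIntegral.integral_congr_ae ?_
  filter_upwards [hgg] with x hx _
  rcases lt_or_ge x 0 with h | h
  · rw [hg.neg x h, hg'.neg x h]
  · exact hx h

-- A simple path has only one arc with a given tail, and all arcs off the path carry nothing almost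
-- everywhere. The sum in the conservation law thus reduces to one arc.
omit [Fintype J] in
theorem sum_src_eq {f : FlowRates J E} (hfP : f.UsesPaths C) (j : J) {k : ℕ}
    (hk : k < (C j).path.length) :
    ∀ᵐ θ, ∑ e with N.src e = N.src (C j).path[k], f.inRate j e θ = f.inRate j (C j).path[k] θ := by
  have hz : ∀ᵐ θ, ∀ e, e ∉ (C j).path → f.inRate j e θ = 0 := by
    rw [ae_all_iff]
    intro e
    by_cases he : e ∈ (C j).path
    · exact Eventually.of_forall fun θ h => absurd he h
    · filter_upwards [(hfP j e he).1] with θ hθ _ using hθ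
  filter_upwards [hz] with θ hθ
  refine Finset.sum_eq_single_of_mem _ (by simp) fun e he hne => hθ e fun hmem => hne ?_
  obtain ⟨i, hi, rfl⟩ := List.getElem_of_mem hmem
  have := (C j).isSimplePath.src_injective hi hk (by simpa using he)
  subst this
  rfl

omit [Fintype J] in
theorem sum_tgt_eq {f : FlowRates J E} (hfP : f.UsesPaths C) (j : J) {k : ℕ}
    (hk : k + 1 < (C j).path.length) :
    ∀ᵐ θ, ∑ e with N.tgt e = N.src (C j).path[k + 1], f.outRate j e θ =
      f.outRate j (C j).path[k] θ := by
  have hz : ∀ᵐ θ, ∀ e, e ∉ (C j).path → f.outRate j e θ = 0 := by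
    rw [ae_all_iff]
    intro e
    by_cases he : e ∈ (C j).path
    · exact Eventually.of_forall fun θ h => absurd he h
    · filter_upwards [(hfP j e he).2] with θ hθ _ using hθ
  filter_upwards [hz] with θ hθ
  refine Finset.sum_eq_single_of_mem _ ?_ fun e he hne => hθ e fun hmem => hne ?_
  · simp [(C j).isSimplePath.tgt_eq_src hk]
  obtain ⟨i, hi, rfl⟩ := List.getElem_of_mem hmem
  have := (C j).isSimplePath.eq_succ_of_tgt_eq_src hi hk (by simpa using he)
  have : i = k := by omega
  subst this
  rfl

omit [Fintype J] in
theorem sum_tgt_zero {f : FlowRates J E} (hfP : f.UsesPaths C) (j : J) :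
    ∀ᵐ θ, ∑ e with N.tgt e = N.src ((C j).path[0]'(C j).isSimplePath.length_pos),
      f.outRate j e θ = 0 := by
  have hz : ∀ᵐ θ, ∀ e, e ∉ (C j).path → f.outRate j e θ = 0 := by
    rw [ae_all_iff]
    intro e
    by_cases he : e ∈ (C j).path
    · exact Eventually.of_forall fun θ h => absurd he h
    · filter_upwards [(hfP j e he).2] with θ hθ _ using hθ
  filter_upwards [hz] with θ hθ
  refine Finset.sum_eq_zero fun e he => hθ e fun hmem => ?_
  obtain ⟨i, hi, rfl⟩ := List.getElem_of_mem hmem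
  have := (C j).isSimplePath.eq_succ_of_tgt_eq_src hi (C j).isSimplePath.length_pos
    (by simpa using he)
  omega

theorem IsFeasible.cumIn_succ (hf : f.IsFeasible N C) (hfP : f.UsesPaths C) (j : J) {k : ℕ}
    (hk : k + 1 < (C j).path.length) :
    f.cumIn j (C j).path[k + 1] = f.cumOut j (C j).path[k] := by
  refine cumulative_congr (hf.isRate_in j _) (hf.isRate_out j _) ?_
  have hp := (C j).isSimplePath
  have ho : N.src (C j).path[k + 1] ≠ (C j).origin := by
    intro he
    have := hp.src_injective hk hp.length_pos (he.trans hp.src_zero.symm)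
    omega
  filter_upwards [hf.conservation j (N.src (C j).path[k + 1]), sum_src_eq hfP j hk,
    sum_tgt_eq hfP j hk] with θ h1 h2 h3 h0
  have := (h1 h0).1 ho (hp.src_ne_dest hk)
  rw [h2, h3] at this
  linarith

theorem IsFeasible.cumIn_zero (hf : f.IsFeasible N C) (hfP : f.UsesPaths C) (j : J) :
    f.cumIn j ((C j).path[0]'(C j).isSimplePath.length_pos) = cumulative (C j).rate := by
  refine cumulative_congr (hf.isRate_in j _) (C j).isRate_rate ?_
  have hp := (C j).isSimplePath
  filter_upwards [hf.conservation j (N.src ((C j).path[0]'hp.length_pos)),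
    sum_src_eq hfP j hp.length_pos, sum_tgt_zero hfP j] with θ h1 h2 h3 h0
  have := (h1 h0).2.1 hp.src_zero
  rw [h2, h3, sub_zero] at this
  rw [this, Commodity.rate, Set.indicator_of_mem (show θ ∈ Set.Ici (0 : ℝ) from h0)]

omit [Fintype J] [Fintype E] [DecidableEq V] in
theorem cumIn_of_notMem (hfP : f.UsesPaths C) {j : J} {e : E} (he : e ∉ (C j).path) (θ : ℝ) :
    f.cumIn j e θ = 0 := by
  unfold cumIn
  rw [intervalIntegral.integral_congr_ae (g := fun _ => 0)]
  · simp
  · filter_upwards [(hfP j e he).1] with x hx _ using hx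

end FlowRates

/-! ### Conservation of packets -/

namespace Loading.IsNetworkLoading

variable {J V E : Type*} {X : Loading J V E} {N : Network V E} {C : J → Commodity N} {α β : ℝ}
  [DecidableEq E] (h : X.IsNetworkLoading N C α β)

theorem _root_.packetCount_filter {J : Type*} (j : J) (L : List (J × ℕ)) (P : J → Prop)
    [DecidablePred fun p : J × ℕ => P p.1] [Decidable (P j)] :
    packetCount j (L.filter (fun p => P p.1)) = if P j then packetCount j L else 0 := by
  classical
  unfold packetCount
  rw [List.countP_filter]
  split_ifs with hj
  · refine List.countP_congr fun p _ => ?_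
    simp only [decide_eq_true_eq, Bool.and_eq_true]
    constructor
    · exact fun h => h.1
    · rintro rfl
      exact ⟨rfl, hj⟩
  · rw [List.countP_eq_zero]
    intro p _ hp
    simp only [decide_eq_true_eq, Bool.and_eq_true] at hp
    rcases hp with ⟨rfl, hp⟩
    exact hj hp

include h

theorem packetCount_entering [Fintype E] (j : J) (t : ℕ) (e : E) :
    packetCount j (X.entering t e) =
      packetCount j (X.lines N C α t e none) +
        ∑ e', packetCount j (X.lines N C α t e (some e')) := by
  have := (h.transition t e).countP_eq (fun p => @decide (p.1 = j) (Classical.propDecidable _))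
  rw [Fintype.sum_option] at this
  exact this

omit [DecidableEq E] h in
theorem _root_.Loading.packetCount_lines_some (j : J) (t : ℕ) (e e' : E)
    [Decidable ([e', e] <:+: (C j).path)] :
    packetCount j (X.lines N C α t e (some e')) =
      if [e', e] <:+: (C j).path then packetCount j (X.leaving N α t e') else 0 := by
  classical
  rw [lines]
  convert packetCount_filter j _ (fun j => [e', e] <:+: (C j).path) using 2

omit [DecidableEq E] h in
theorem _root_.Loading.packetCount_lines_none (j : J) (t : ℕ) (e : E)
    [Decidable ((C j).path.head? = some e)] :
    packetCount j (X.lines N C α t e none) =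
      if (C j).path.head? = some e then packetCount j (X.released t (N.src e)) else 0 := by
  classical
  rw [lines]
  convert packetCount_filter j _ (fun j => (C j).path.head? = some e) using 2

theorem inCount_succ [Fintype E] (j : J) {k : ℕ} (hk : k + 1 < (C j).path.length) (t : ℕ) :
    X.inCount j (C j).path[k + 1] t = X.outCount N α j (C j).path[k] t := by
  classical
  have hp := (C j).isSimplePath
  refine Finset.sum_congr rfl fun s _ => ?_
  rw [h.packetCount_entering, packetCount_lines_none, if_neg, zero_add]
  · simp only [packetCount_lines_some, hp.pair_infix_iff hk]
    simp
  · rw [List.head?_eq_getElem?, List.getElem?_eq_getElem hp.length_pos, Option.some_inj]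
    intro he
    have := (hp.nodup.getElem_inj_iff).1 he
    omega

theorem inCount_of_notMem [Fintype E] {j : J} {e : E} (he : e ∉ (C j).path) (t : ℕ) :
    X.inCount j e t = 0 := by
  classical
  refine Finset.sum_eq_zero fun s _ => ?_
  rw [h.packetCount_entering, packetCount_lines_none, if_neg, zero_add]
  · refine Finset.sum_eq_zero fun e' _ => ?_
    rw [packetCount_lines_some, if_neg]
    intro hi
    exact he (hi.subset (by simp))
  · intro hh
    exact he (List.mem_of_mem_head? hh)

theorem packetCount_released (j : J) (t : ℕ) :
    packetCount j (X.released t (C j).origin) =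
      ((Finset.Icc 1 ((C j).numPackets β)).filter
        (fun i => (C j).releaseStep α β i = t)).card := by
  classical
  set L := (X.released t (C j).origin).filter (fun p => p.1 = j) with hL
  -- The prescribed order within a commodity is strict, which excludes repetitions; list length and
  -- number of released indices therefore agree.
  have hnd : (L.map Prod.snd).Nodup := by
    have h1 : L.Pairwise (fun p q => p.1 = q.1 → p.2 < q.2) := (h.released_order t _).filter _
    rw [List.Nodup, List.pairwise_map]
    refine h1.imp_of_mem fun {p q} hp hq hpq => ?_
    rw [hL, List.mem_filter] at hp hq
    simp only [decide_eq_true_eq] at hp hq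
    exact (hpq (hp.2.trans hq.2.symm)).ne
  have h2 : packetCount j (X.released t (C j).origin) = (L.map Prod.snd).length := by
    rw [List.length_map, hL, ← List.countP_eq_length_filter]
    unfold packetCount
    congr!
  rw [h2, ← List.toFinset_card_of_nodup hnd]
  congr 1
  ext i
  simp only [List.mem_toFinset, List.mem_map, hL, List.mem_filter, decide_eq_true_eq,
    Finset.mem_filter, Finset.mem_Icc]
  constructor
  · rintro ⟨⟨j', i'⟩, ⟨hm, rfl⟩, rfl⟩
    have := (h.mem_released t _ _ _).1 hm
    exact ⟨⟨this.2.1, this.2.2.1⟩, this.2.2.2⟩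
  · rintro ⟨⟨h1, h2⟩, h3⟩
    exact ⟨(j, i), ⟨(h.mem_released t _ _ _).2 ⟨rfl, h1, h2, h3⟩, rfl⟩, rfl⟩

theorem inCount_zero_eq_card [Fintype E] (j : J) (t : ℕ) :
    X.inCount j ((C j).path[0]'(C j).isSimplePath.length_pos) t =
      ((Finset.Icc 1 ((C j).numPackets β)).filter
        (fun i => (C j).releaseStep α β i < t)).card := by
  classical
  have hp := (C j).isSimplePath
  have h1 : ∀ s, packetCount j (X.entering s ((C j).path[0]'hp.length_pos)) =
      ((Finset.Icc 1 ((C j).numPackets β)).filter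
        (fun i => (C j).releaseStep α β i = s)).card := by
    intro s
    rw [h.packetCount_entering, packetCount_lines_none, if_pos, Finset.sum_eq_zero, add_zero,
      hp.src_zero, h.packetCount_released]
    · intro e' _
      rw [packetCount_lines_some, if_neg (hp.not_pair_infix_zero e')]
    · rw [List.head?_eq_getElem?, List.getElem?_eq_getElem hp.length_pos]
  rw [inCount, Finset.sum_congr rfl fun s _ => h1 s]
  rw [Finset.card_eq_sum_card_fiberwise (f := fun i => (C j).releaseStep α β i)
    (t := Finset.range t)]
  · refine Finset.sum_congr rfl fun s hs => ?_
    congr 1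
    ext i
    simp only [Finset.mem_filter, Finset.mem_range] at hs ⊢
    constructor
    · rintro ⟨h1, h2⟩
      exact ⟨⟨h1, h2.trans_lt hs⟩, h2⟩
    · rintro ⟨⟨h1, -⟩, h2⟩
      exact ⟨h1, h2⟩
  · intro i hi
    simp only [Finset.coe_filter, Set.mem_ofPred_eq] at hi
    simpa using hi.2

/-- The shift arises because counts stop before their step: those before step `t + 1` include the
release in step `t`, which sees the supply up to `α t`. -/
theorem inCount_zero_succ [Fintype E] (hα : 0 < α) (hβ : 0 < β) (j : J) (t : ℕ) :
    X.inCount j ((C j).path[0]'(C j).isSimplePath.length_pos) (t + 1) =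
      ⌊cumulative (C j).rate (α * t) / β⌋₊ := by
  rw [h.inCount_zero_eq_card, (C j).card_released hα hβ]

theorem outCount_le_inCount (hα : 0 < α) (j : J) (e : E) (t : ℕ) :
    X.outCount N α j e t ≤ X.inCount j e t := by
  have h1 := h.outCount_le_add hα j e t t
  have h2 := h.numLeft_le hα e t
  have h3 := X.numEntered_mono e (Nat.sub_le t (delay N α e))
  omega

end Loading.IsNetworkLoading

/-! ### Comparison of an arc in the two models -/

namespace Loading.IsNetworkLoading

variable {J V E : Type*} {X : Loading J V E} {N : Network V E} {C : J → Commodity N} {α β : ℝ}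
  [DecidableEq E] (h : X.IsNetworkLoading N C α β) (hα : 0 < α) (hβ : 0 < β)
  {e : E} {a b : ℝ → ℝ} (hq : IsQueueFlow (N.tau e) (N.nu e) a b)
include h hα hβ hq

theorem abs_numLeft_sub_cumulative_le {H δ : ℝ} (hδ : 0 ≤ δ)
    (hin : ∀ t : ℕ, α * t ≤ H → |β * X.numEntered e t - cumulative a (α * t)| ≤ δ)
    {t : ℕ} (ht : α * t ≤ H + N.tau e) :
    |β * X.numLeft N α e t - cumulative b (α * t)| ≤ δ + N.nu e * α + β := by
  have hc1 : N.tau e / α ≤ (delay N α e : ℝ) := Nat.le_ceil _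
  have hc2 : (delay N α e : ℝ) < N.tau e / α + 1 :=
    Nat.ceil_lt_add_one (div_pos hq.tau_pos hα).le
  rw [div_le_iff₀' hα] at hc1
  have hc2' : α * (delay N α e : ℝ) ≤ N.tau e + α := by
    have := mul_lt_mul_of_pos_left hc2 hα
    rw [mul_add, mul_div_cancel₀ _ hα.ne'] at this
    linarith
  have hν := hq.nu_pos
  have hβν : β * (N.nu e * α / β) = N.nu e * α := by field_simp
  rw [abs_le]
  constructor
  · obtain ⟨s, hst, hs⟩ := h.exists_numLeft_ge hα hβ e t
    have hs' : (s : ℝ) ≤ t := by exact_mod_cast hst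
    have hαs : α * s ≤ α * t := by gcongr
    have h1 := mul_le_mul_of_nonneg_left hs hβ.le
    -- Rounding makes `α * delay` exceed `τ` by at most `α`. Shifting the comparison point back by
    -- `α` puts its entrance time below `α (s - delay)`, at the cost of `ν α`.
    have h2 := hq.cumulative_out_le_add (ξ := α * s - α) (θ := α * t) (by linarith)
    have h3 : cumulative a (α * s - α - N.tau e) ≤
        β * X.numEntered e (s - delay N α e) + δ := by
      rcases le_total (delay N α e) s with hle | hle
      · have h4 : (((s - delay N α e : ℕ) : ℕ) : ℝ) = s - delay N α e := Nat.cast_sub hle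
        have h5 := hin (s - delay N α e) (by rw [h4]; linarith)
        have h6 : cumulative a (α * s - α - N.tau e) ≤
            cumulative a (α * ((s - delay N α e : ℕ) : ℕ)) :=
          hq.inflow.cumulative_mono (by rw [h4]; linarith)
        linarith [(abs_le.1 h5).1]
      · have : (s : ℝ) ≤ delay N α e := by exact_mod_cast hle
        have h4 : α * s ≤ α * delay N α e := by gcongr
        rw [hq.inflow.cumulative_of_nonpos (by linarith)]
        positivity
    have h7 : β * (X.numEntered e (s - delay N α e) + N.nu e * α / β * (t - s) - 1 : ℝ) =
        β * X.numEntered e (s - delay N α e) + N.nu e * α * (t - s) - β := by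
      linear_combination ((t : ℝ) - s) * hβν
    rw [h7] at h1
    nlinarith
  -- For the opposite bound the minimizer of the continuous formula is rounded down to the grid and
  -- inserted into the discrete one.
  · obtain ⟨ξ, hξ0, hξt, hξ⟩ := hq.exists_cumulative_out_eq (θ := α * t) (by positivity)
    set s := ⌊ξ / α⌋₊ with hs
    have hs1 : α * s ≤ ξ := by
      have := Nat.floor_le (div_nonneg hξ0 hα.le)
      rwa [le_div_iff₀' hα] at this
    have hs2 : ξ ≤ α * s + α := by
      have := (Nat.lt_floor_add_one (ξ / α)).le
      rw [div_le_iff₀' hα] at this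
      linarith
    have hst : s ≤ t := by
      have : α * s ≤ α * t := hs1.trans hξt
      exact_mod_cast le_of_mul_le_mul_left this hα
    have h1 := mul_le_mul_of_nonneg_left (h.numLeft_le_add hα hβ e hst) hβ.le
    have h3 : β * X.numEntered e (s - delay N α e) ≤ cumulative a (ξ - N.tau e) + δ := by
      rcases le_total (delay N α e) s with hle | hle
      · have h4 : (((s - delay N α e : ℕ) : ℕ) : ℝ) = s - delay N α e := Nat.cast_sub hle
        have h5 := hin (s - delay N α e) (by rw [h4]; linarith)
        have h6 : cumulative a (α * ((s - delay N α e : ℕ) : ℕ)) ≤ cumulative a (ξ - N.tau e) :=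
          hq.inflow.cumulative_mono (by rw [h4]; linarith)
        linarith [(abs_le.1 h5).2]
      · rw [Nat.sub_eq_zero_of_le hle]
        have := hq.inflow.cumulative_nonneg (ξ - N.tau e)
        simp only [numEntered, Finset.range_zero, Finset.sum_empty, Nat.cast_zero, mul_zero]
        linarith
    have h7 : β * (X.numEntered e (s - delay N α e) + N.nu e * α / β * (t - s) + 1 : ℝ) =
        β * X.numEntered e (s - delay N α e) + N.nu e * α * (t - s) + β := by
      linear_combination ((t : ℝ) - s) * hβν
    rw [h7] at h1
    nlinarith

/-- Let `ξ` be the entrance time belonging to `α t`. Then the outflow at `α t` equals the inflow at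
`ξ`, in total and for the commodity. Closeness of the totals makes the departures by `t` almost the
entries by the grid point below `ξ`, and the discrete FIFO bound carries this to the commodity. -/
theorem abs_outCount_sub_cumulative_le {aj bj : ℝ → ℝ} (haj : IsRate aj)
    (hle : ∀ x, aj x ≤ a x) {L : ℝ} (hL : ∀ x, a x ≤ L)
    (hfifo : ∀ ξ, cumulative bj (queueExit (N.tau e) (N.nu e) a b ξ) = cumulative aj ξ)
    (j : J) {H δ : ℝ} (hH : 0 ≤ H) (hδ : 0 ≤ δ)
    (hin : ∀ t : ℕ, α * t ≤ H → |β * X.numEntered e t - cumulative a (α * t)| ≤ δ)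
    (hinj : ∀ t : ℕ, α * t ≤ H → |β * X.inCount j e t - cumulative aj (α * t)| ≤ δ)
    {t : ℕ} (ht : α * t ≤ H + N.tau e) :
    |β * X.outCount N α j e t - cumulative bj (α * t)| ≤
      3 * δ + N.nu e * α + β + 2 * (L * α) := by
  have hL0 : 0 ≤ L := (hq.inflow.nonneg 0).trans (hL 0)
  set ϑ := queueEntrance (N.tau e) (N.nu e) a b (α * t) with hϑ
  have hTϑ := hq.queueExit_queueEntrance (α * t)
  rw [← hϑ] at hTϑ
  have hϑle : ϑ + N.tau e ≤ α * t := by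
    have := hq.le_queueExit ϑ
    rwa [hTϑ] at this
  -- The entrance time is negative if `α t < τ`; replacing it by `0` changes no cumulative value and
  -- allows rounding to a natural number.
  have hmax : ∀ {g : ℝ → ℝ}, IsRate g → cumulative g (max ϑ 0) = cumulative g ϑ := by
    intro g hg
    rcases le_total ϑ 0 with h0 | h0
    · rw [max_eq_right h0, hg.cumulative_of_nonpos h0, hg.cumulative_of_nonpos le_rfl]
    · rw [max_eq_left h0]
  set ξ := max ϑ 0 with hξ
  have hb : cumulative b (α * t) = cumulative a ξ := by
    rw [hmax hq.inflow, ← hq.cumulative_out_queueExit, hTϑ]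
  have hbj : cumulative bj (α * t) = cumulative aj ξ := by
    rw [hmax haj, ← hfifo, hTϑ]
  have hξ0 : 0 ≤ ξ := le_max_right _ _
  have hξH : ξ ≤ H := max_le (by linarith) hH
  set s := ⌊ξ / α⌋₊ with hs
  have hs1 : α * s ≤ ξ := by
    have := Nat.floor_le (div_nonneg hξ0 hα.le)
    rwa [le_div_iff₀' hα] at this
  have hs2 : ξ ≤ α * s + α := by
    have := (Nat.lt_floor_add_one (ξ / α)).le
    rw [div_le_iff₀' hα] at this
    linarith
  have hl1 := hq.inflow.cumulative_lipschitz hL hs1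
  have hl2 := haj.cumulative_lipschitz (fun x => (hle x).trans (hL x)) hs1
  have hl3 := hq.inflow.cumulative_mono hs1
  have hl4 := haj.cumulative_mono hs1
  have hl5 : L * (ξ - α * s) ≤ L * α := mul_le_mul_of_nonneg_left (by linarith) hL0
  have h1 := abs_le.1 (h.abs_numLeft_sub_cumulative_le hα hβ hq hδ hin ht)
  have h2 := abs_le.1 (hin s (hs1.trans hξH))
  have h3 := abs_le.1 (hinj s (hs1.trans hξH))
  have h4 : |β * X.outCount N α j e t - β * X.inCount j e s| ≤
      |β * X.numLeft N α e t - β * X.numEntered e s| := by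
    rw [← mul_sub, ← mul_sub, abs_mul, abs_mul]
    exact mul_le_mul_of_nonneg_left (h.abs_outCount_sub_inCount_le hα j e s t) (abs_nonneg _)
  have h5 : |β * X.numLeft N α e t - β * X.numEntered e s| ≤
      2 * δ + N.nu e * α + β + L * α := by
    rw [hb] at h1
    rw [abs_le]
    constructor <;> linarith
  have h6 := abs_le.1 (h4.trans h5)
  rw [hbj, abs_le]
  constructor <;> linarith

end Loading.IsNetworkLoading

/-! ### Convergence on the grid of time steps -/

section Convergence

variable {V E J : Type*} [Fintype E] [Fintype J] [DecidableEq V] [DecidableEq E]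
  {N : Network V E} {C : J → Commodity N} {f : FlowRates J E}
  (hf : f.IsFeasible N C) (hfP : f.UsesPaths C)
  {α β : ℕ → ℝ} (hα : ∀ n, 0 < α n) (hβ : ∀ n, 0 < β n)
  (hα0 : Tendsto α atTop (𝓝 0)) (hβ0 : Tendsto β atTop (𝓝 0))
  {X : ℕ → Loading J V E} (hX : ∀ n, (X n).IsNetworkLoading N C (α n) (β n))

/-- Convergence of the cumulative inflow of the arcs on the time steps up to time `H`. -/
def InflowConverges (f : FlowRates J E) (α β : ℕ → ℝ) (X : ℕ → Loading J V E) (H : ℝ) : Prop :=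
  ∀ j e, ∀ ε > 0, ∀ᶠ n in atTop, ∀ t : ℕ, α n * t ≤ H →
    |β n * (X n).inCount j e t - f.cumIn j e (α n * t)| ≤ ε

omit [DecidableEq E] in
include hf in
theorem InflowConverges.total {H : ℝ} (hH : InflowConverges f α β X H) (e : E) {ε : ℝ}
    (hε : 0 < ε) : ∀ᶠ n in atTop, ∀ t : ℕ, α n * t ≤ H →
      |β n * (X n).numEntered e t - cumulative (f.totalIn e) (α n * t)| ≤ ε := by
  have hpos : 0 < ε / (Fintype.card J + 1) := by positivity
  filter_upwards [eventually_all.2 fun j => hH j e _ hpos] with n hn t ht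
  rw [(X n).numEntered_eq_sum, hf.cumulative_totalIn]
  push_cast
  rw [Finset.mul_sum, ← Finset.sum_sub_distrib]
  refine (Finset.abs_sum_le_sum_abs _ _).trans ?_
  refine (Finset.sum_le_sum fun j _ => hn j t ht).trans ?_
  rw [Finset.sum_const, nsmul_eq_mul, Finset.card_univ, mul_div_assoc', div_le_iff₀ (by positivity)]
  nlinarith

include hf hα hβ hα0 hβ0 hX

/-- The gain of `τ_e` in the horizon drives the induction: what leaves by `H + τ_e` entered by `H`.
-/
theorem InflowConverges.outflow {H : ℝ} (hH : InflowConverges f α β X H) (hH0 : 0 ≤ H) (j : J)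
    (e : E) {ε : ℝ} (hε : 0 < ε) : ∀ᶠ n in atTop, ∀ t : ℕ, α n * t ≤ H + N.tau e →
      |β n * (X n).outCount N (α n) j e t - f.cumOut j e (α n * t)| ≤ ε := by
  obtain ⟨L, hL⟩ := (hf.isRate_totalIn e).bounded
  have hlim : Tendsto (fun n => N.nu e * α n + β n + 2 * (L * α n)) atTop (𝓝 0) := by
    have := ((hα0.const_mul (N.nu e)).add hβ0).add ((hα0.const_mul L).const_mul 2)
    simpa using this
  have hδ : 0 < ε / 4 := by positivity
  filter_upwards [hH.total hf e hδ, hH j e _ hδ, hlim.eventually (gt_mem_nhds hδ)] with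
    n h1 h2 h3 t ht
  have h4 := (hX n).abs_outCount_sub_cumulative_le (hα n) (hβ n) (hf.isQueueFlow e)
    (hf.isRate_in j e) (bj := f.outRate j e)
    (fun x => Finset.single_le_sum (f := fun j => f.inRate j e x)
      (fun i _ => hf.in_nonneg i e x) (Finset.mem_univ j)) hL
    (fun ξ => by
      have := hf.cumOut_exitTime j e ξ
      rw [hf.exitTime_eq] at this
      exact this) j hH0 hδ.le h1 h2 ht
  refine h4.trans ?_
  linarith

include hfP

/-- On a first arc the inflow is the supply, known at all times up to the rounding `β` and the lag
of one time step; on a later arc it is the outflow of the preceding arc, whose convergence reaches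
further by a transit time. -/
theorem InflowConverges.step {H τ : ℝ} (hH : InflowConverges f α β X H) (hH0 : 0 ≤ H)
    (hτ : ∀ e, τ ≤ N.tau e) : InflowConverges f α β X (H + τ) := by
  intro j e ε hε
  by_cases he : e ∈ (C j).path
  swap
  · refine Eventually.of_forall fun n t _ => ?_
    rw [(hX n).inCount_of_notMem he, FlowRates.cumIn_of_notMem hfP he]
    simpa using hε.le
  obtain ⟨k, hk, rfl⟩ := List.getElem_of_mem he
  cases k with
  | zero =>
    have hr := (C j).isRate_rate
    obtain ⟨B, hB⟩ := hr.bounded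
    have hlim : Tendsto (fun n => β n + B * α n) atTop (𝓝 0) := by
      have := hβ0.add (hα0.const_mul B)
      simpa using this
    filter_upwards [hlim.eventually (gt_mem_nhds hε)] with n hn t _
    rw [hf.cumIn_zero hfP]
    cases t with
    | zero =>
      have := hr.cumulative_of_nonpos (θ := 0) le_rfl
      simpa [Loading.inCount, this] using hε.le
    | succ t =>
      rw [(hX n).inCount_zero_succ (hα n) (hβ n)]
      set u := cumulative (C j).rate (α n * t) with hu
      have hu0 : 0 ≤ u := hr.cumulative_nonneg _
      have hαn := hα n
      have hβn := hβ n
      have h1 : β n * (⌊u / β n⌋₊ : ℕ) ≤ u := by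
        have := Nat.floor_le (div_nonneg hu0 hβn.le)
        rwa [le_div_iff₀' hβn] at this
      have h2 : u ≤ β n * (⌊u / β n⌋₊ : ℕ) + β n := by
        have := (Nat.lt_floor_add_one (u / β n)).le
        rw [div_le_iff₀' hβn] at this
        linarith
      have hle : α n * t ≤ α n * (t + 1 : ℕ) := by push_cast; linarith
      have h3 := hr.cumulative_lipschitz hB hle
      have h4 := hr.cumulative_mono hle
      have h5 : B * (α n * (t + 1 : ℕ) - α n * t) = B * α n := by push_cast; ring
      rw [h5] at h3
      rw [abs_le]
      constructor <;> linarith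
  | succ k =>
    rw [hf.cumIn_succ hfP]
    filter_upwards [hH.outflow hf hα hβ hα0 hβ0 hX hH0 j (C j).path[k] hε] with n hn t ht
    rw [(hX n).inCount_succ]
    exact hn t (ht.trans (by linarith [hτ (C j).path[k]]))

/-- Induction on the horizon in units of the smallest transit time. The horizon `0` contains only
step `0`, before which nothing has entered. -/
theorem inflowConverges (H : ℝ) : InflowConverges f α β X H := by
  obtain ⟨τ, hτ0, hτ⟩ : ∃ τ, 0 < τ ∧ ∀ e, τ ≤ N.tau e := by
    cases isEmpty_or_nonempty E with
    | inl _ => exact ⟨1, one_pos, fun e => isEmptyElim e⟩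
    | inr _ =>
      obtain ⟨e, he⟩ := Finite.exists_min N.tau
      exact ⟨N.tau e, N.tau_pos e, he⟩
  have key : ∀ m : ℕ, InflowConverges f α β X (m * τ) := by
    intro m
    induction m with
    | zero =>
      intro j e ε hε
      refine Eventually.of_forall fun n t ht => ?_
      have ht0 : t = 0 := by
        by_contra hne
        have : 0 < (t : ℝ) := by exact_mod_cast Nat.pos_of_ne_zero hne
        have := mul_pos (hα n) this
        simp only [Nat.cast_zero, zero_mul] at ht
        linarith
      subst ht0
      have : f.cumIn j e 0 = 0 := (hf.isRate_in j e).cumulative_of_nonpos le_rfl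
      simpa [Loading.inCount, this] using hε.le
    | succ m ih =>
      have := ih.step hf hfP hα hβ hα0 hβ0 hX (by positivity) hτ
      push_cast
      rwa [add_mul, one_mul]
  obtain ⟨m, hm⟩ := exists_nat_ge (H / τ)
  rw [div_le_iff₀ hτ0] at hm
  intro j e ε hε
  filter_upwards [key m j e ε hε] with n hn t ht using hn t (ht.trans hm)

theorem outflowConverges (H : ℝ) (j : J) (e : E) {ε : ℝ} (hε : 0 < ε) :
    ∀ᶠ n in atTop, ∀ t : ℕ, α n * t ≤ H →
      |β n * (X n).outCount N (α n) j e t - f.cumOut j e (α n * t)| ≤ ε := by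
  filter_upwards [(inflowConverges hf hfP hα hβ hα0 hβ0 hX (max H 0)).outflow hf hα hβ hα0 hβ0 hX
    (le_max_right _ _) j e hε] with n hn t ht
  exact hn t (ht.trans ((le_max_left _ _).trans (by linarith [N.tau_pos e])))

theorem totalOutflowConverges (H : ℝ) (e : E) {ε : ℝ} (hε : 0 < ε) :
    ∀ᶠ n in atTop, ∀ t : ℕ, α n * t ≤ H →
      |β n * (X n).numLeft N (α n) e t - cumulative (f.totalOut e) (α n * t)| ≤ ε := by
  have hpos : 0 < ε / (Fintype.card J + 1) := by positivity
  filter_upwards [eventually_all.2 fun j =>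
    outflowConverges hf hfP hα hβ hα0 hβ0 hX H j e hpos] with n hn t ht
  rw [(X n).numLeft_eq_sum, hf.cumulative_totalOut]
  push_cast
  rw [Finset.mul_sum, ← Finset.sum_sub_distrib]
  refine (Finset.abs_sum_le_sum_abs _ _).trans ?_
  refine (Finset.sum_le_sum fun j _ => hn j t ht).trans ?_
  rw [Finset.sum_const, nsmul_eq_mul, Finset.card_univ, mul_div_assoc', div_le_iff₀ (by positivity)]
  nlinarith

end Convergence

/-! ### Cumulative functions of step rates -/

/-- The cumulative function of the rate that is `β / α * x t` during the time step
`(α (t - 1), α t]`. -/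
noncomputable def stepCumulative (α β : ℝ) (x : ℕ → ℕ) (θ : ℝ) : ℝ :=
  ∫ ξ in (0 : ℝ)..θ, β / α * (x ⌈ξ / α⌉₊ : ℝ)

section StepCumulative

variable {α β : ℝ} (hα : 0 < α) (hβ : 0 < β) (x : ℕ → ℕ)
include hα hβ

theorem intervalIntegrable_stepRate (a b : ℝ) :
    IntervalIntegrable (fun ξ => β / α * (x ⌈ξ / α⌉₊ : ℝ)) volume a b := by
  have hm : Measurable fun ξ : ℝ => β / α * (x ⌈ξ / α⌉₊ : ℝ) := by
    have h1 : Measurable fun ξ : ℝ => ⌈ξ / α⌉₊ := Nat.measurable_ceil.comp (measurable_id.div_const α)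
    have h2 : Measurable fun n : ℕ => β / α * (x n : ℝ) := measurable_from_nat
    exact h2.comp h1
  refine IntegrableOn.intervalIntegrable (Measure.integrableOn_of_bounded
    (M := β / α * ∑ s ∈ Finset.range (⌈max a b / α⌉₊ + 1), (x s : ℝ)) ?_ hm.aestronglyMeasurable ?_)
  · exact isCompact_uIcc.measure_lt_top.ne
  · refine (ae_restrict_iff' measurableSet_uIcc).2 (Eventually.of_forall fun ξ hξ => ?_)
    rw [Real.norm_of_nonneg (by positivity)]
    refine mul_le_mul_of_nonneg_left ?_ (by positivity)
    refine Finset.single_le_sum (f := fun s => (x s : ℝ)) (fun _ _ => Nat.cast_nonneg _) ?_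
    rw [Finset.mem_range, Nat.lt_succ_iff]
    exact Nat.ceil_mono (div_le_div_of_nonneg_right hξ.2 hα.le)

theorem continuous_stepCumulative : Continuous (stepCumulative α β x) :=
  intervalIntegral.continuous_primitive (intervalIntegrable_stepRate hα hβ x) 0

theorem stepCumulative_mono : Monotone (stepCumulative α β x) := by
  intro a b hab
  have h1 : stepCumulative α β x b - stepCumulative α β x a =
      ∫ ξ in a..b, β / α * (x ⌈ξ / α⌉₊ : ℝ) :=
    intervalIntegral.integral_interval_sub_left (intervalIntegrable_stepRate hα hβ x _ _)
      (intervalIntegrable_stepRate hα hβ x _ _)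
  have h2 : 0 ≤ ∫ ξ in a..b, β / α * (x ⌈ξ / α⌉₊ : ℝ) :=
    intervalIntegral.integral_nonneg hab fun u _ => by positivity
  linarith

/-- The value of the rate for step `0` is taken only at the single point `0` of `[0, ∞)` and is
invisible to the integral, hence the assumption `h0`. Step `t` ends at `α t`, so it is included in
the sum. -/
theorem stepCumulative_mul (h0 : x 0 = 0) (t : ℕ) :
    stepCumulative α β x (α * t) = β * (∑ s ∈ Finset.range (t + 1), x s : ℕ) := by
  induction t with
  | zero => simp [stepCumulative, h0]
  | succ t ih =>
    have h1 : stepCumulative α β x (α * (t + 1 : ℕ)) = stepCumulative α β x (α * t) +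
        ∫ ξ in (α * t)..(α * (t + 1 : ℕ)), β / α * (x ⌈ξ / α⌉₊ : ℝ) :=
      (intervalIntegral.integral_add_adjacent_intervals (intervalIntegrable_stepRate hα hβ x _ _)
        (intervalIntegrable_stepRate hα hβ x _ _)).symm
    have hle : α * t ≤ α * (t + 1 : ℕ) := by push_cast; linarith
    have h2 : ∫ ξ in (α * t)..(α * (t + 1 : ℕ)), β / α * (x ⌈ξ / α⌉₊ : ℝ) = β * x (t + 1) := by
      rw [intervalIntegral.integral_of_le hle,
        setIntegral_congr_fun (g := fun _ => β / α * (x (t + 1) : ℝ)) measurableSet_Ioc]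
      · rw [← intervalIntegral.integral_of_le hle, intervalIntegral.integral_const, smul_eq_mul]
        push_cast
        field_simp
        ring
      · intro ξ hξ
        have : ⌈ξ / α⌉₊ = t + 1 := by
          rw [Nat.ceil_eq_iff (Nat.succ_ne_zero t), lt_div_iff₀' hα, div_le_iff₀' hα]
          simpa using hξ
        simp only [this]
    rw [h1, h2, ih, Finset.sum_range_succ _ (t + 1)]
    push_cast
    ring

end StepCumulative

section Sandwich

variable {α β : ℕ → ℝ} (hα : ∀ n, 0 < α n) (hβ : ∀ n, 0 < β n) (hα0 : Tendsto α atTop (𝓝 0))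
  {g : ℝ → ℝ} (hg : IsRate g) {x : ℕ → ℕ → ℕ} (hx0 : ∀ n, x n 0 = 0)
  (hconv : ∀ H, ∀ ε > 0, ∀ᶠ n in atTop, ∀ t : ℕ, α n * t ≤ H →
    |β n * (∑ s ∈ Finset.range t, x n s : ℕ) - cumulative g (α n * t)| ≤ ε)
include hα hβ hα0 hg hx0 hconv

/-- Convergence on the grid of time steps implies uniform convergence on bounded intervals. -/
theorem eventually_abs_stepCumulative_sub_le (H : ℝ) {ε : ℝ} (hε : 0 < ε) :
    ∀ᶠ n in atTop, ∀ θ, 0 ≤ θ → θ ≤ H →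
      |stepCumulative (α n) (β n) (x n) θ - cumulative g θ| ≤ ε := by
  obtain ⟨B, hB⟩ := hg.bounded
  have hB0 : 0 ≤ B := (hg.nonneg 0).trans (hB 0)
  have hlim : Tendsto (fun n => 2 * (B * α n)) atTop (𝓝 0) := by
    simpa using (hα0.const_mul B).const_mul 2
  -- Rounding `θ` to the grid and the shift by one step between `stepCumulative_mul` and `hconv`
  -- move the time by at most `2 α`. This explains the horizon `H + 2` and the error `2 B α`.
  filter_upwards [hconv (H + 2) (ε / 2) (by positivity), hlim.eventually (gt_mem_nhds (half_pos hε)),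
    hα0.eventually (gt_mem_nhds one_pos)] with n h1 h2 h3 θ hθ0 hθH
  have hαn := hα n
  have hmono := stepCumulative_mono hαn (hβ n) (x n)
  rw [abs_le]
  constructor
  · set s := ⌊θ / α n⌋₊
    have hs1 : α n * s ≤ θ := by
      have := Nat.floor_le (div_nonneg hθ0 hαn.le)
      rwa [le_div_iff₀' hαn] at this
    have hs2 : θ ≤ α n * (s + 1 : ℕ) := by
      have := (Nat.lt_floor_add_one (θ / α n)).le
      rw [div_le_iff₀' hαn] at this
      push_cast
      exact this
    have h4 := hmono hs1
    rw [stepCumulative_mul hαn (hβ n) _ (hx0 n)] at h4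
    have h5 := (abs_le.1 (h1 (s + 1) (by push_cast; linarith))).1
    have h6 := hg.cumulative_mono hs2
    linarith
  · set s := ⌈θ / α n⌉₊
    have hs1 : θ ≤ α n * s := by
      have := Nat.le_ceil (θ / α n)
      rwa [div_le_iff₀' hαn] at this
    have hs2 : α n * s ≤ θ + α n := by
      have := (Nat.ceil_lt_add_one (div_nonneg hθ0 hαn.le)).le
      have := mul_le_mul_of_nonneg_left this hαn.le
      rwa [mul_add, mul_div_cancel₀ _ hαn.ne', mul_one] at this
    have h4 := hmono hs1
    rw [stepCumulative_mul hαn (hβ n) _ (hx0 n)] at h4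
    have hs3 : α n * (s + 1 : ℕ) ≤ θ + 2 * α n := by push_cast; linarith
    have h5 := (abs_le.1 (h1 (s + 1) (by linarith))).2
    have h6 := hg.cumulative_lipschitz hB (a := θ) (b := α n * (s + 1 : ℕ)) (by push_cast; linarith)
    have h7 : B * (α n * (s + 1 : ℕ) - θ) ≤ B * (2 * α n) :=
      mul_le_mul_of_nonneg_left (by linarith) hB0
    linarith

/-- Beyond `T` both functions are monotone, bounded by `M` and already within the error of `M`, so
the bounded interval up to `T` decides. -/
theorem tendstoUniformlyOn_stepCumulative {M T : ℝ} (hM : ∀ θ, cumulative g θ ≤ M)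
    (hT : cumulative g T = M) (hxM : ∀ n t, β n * (∑ s ∈ Finset.range t, x n s : ℕ) ≤ M) :
    TendstoUniformlyOn (fun n => stepCumulative (α n) (β n) (x n)) (cumulative g) atTop
      (Set.Ici 0) := by
  rw [Metric.tendstoUniformlyOn_iff]
  intro ε hε
  filter_upwards [eventually_abs_stepCumulative_sub_le hα hβ hα0 hg hx0 hconv (max T 0)
    (half_pos hε)] with n hn θ hθ
  rw [dist_comm, Real.dist_eq]
  refine lt_of_le_of_lt ?_ (half_lt_self hε)
  rcases le_total θ (max T 0) with h | h
  · exact hn θ hθ h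
  · have h1 := (abs_le.1 (hn _ (le_max_right T 0) le_rfl)).1
    have h2 := hg.cumulative_mono (le_max_left T 0)
    have h3 := hg.cumulative_mono h
    have hmono := stepCumulative_mono (hα n) (hβ n) (x n)
    have h4 := hmono h
    have hs1 : θ ≤ α n * ⌈θ / α n⌉₊ := by
      have := Nat.le_ceil (θ / α n)
      rwa [div_le_iff₀' (hα n)] at this
    have h5 := hmono hs1
    rw [stepCumulative_mul (hα n) (hβ n) _ (hx0 n)] at h5
    have h6 := hxM n (⌈θ / α n⌉₊ + 1)
    have h7 := hM θ
    rw [abs_le]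
    constructor <;> linarith

end Sandwich

/-! ### Passing the nodes of a path -/

namespace FlowRates

variable {J V E : Type*} [Fintype J] [Fintype E] [DecidableEq V]
  {f : FlowRates J E} {N : Network V E} {C : J → Commodity N}

/-- The rate at which commodity `j` passes the `k`-th node of its path. -/
noncomputable def passRate (f : FlowRates J E) (C : J → Commodity N) (j : J) (k : ℕ) : ℝ → ℝ :=
  if hk : k < (C j).path.length then f.inRate j (C j).path[k]
  else f.outRate j ((C j).path[(C j).path.length - 1]'
    (Nat.sub_lt (C j).isSimplePath.length_pos one_pos))

/-- The arrival time at the `k`-th node of the path. -/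
noncomputable def passTime (f : FlowRates J E) (C : J → Commodity N) (j : J) (k : ℕ) (φ : ℝ) : ℝ :=
  ((C j).path.take k).foldl (fun θ e => f.exitTime N e θ) ((C j).releaseTime φ)

omit [Fintype J] [Fintype E] [DecidableEq V] in
theorem cumulative_passRate_of_lt (f : FlowRates J E) (C : J → Commodity N) (j : J) {k : ℕ}
    (hk : k < (C j).path.length) :
    cumulative (f.passRate C j k) = f.cumIn j (C j).path[k] := by
  rw [passRate, dif_pos hk]
  rfl

omit [Fintype E] [DecidableEq V] in
theorem passTime_succ (f : FlowRates J E) (C : J → Commodity N) (j : J) {k : ℕ}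
    (hk : k < (C j).path.length) (φ : ℝ) :
    f.passTime C j (k + 1) φ = f.exitTime N (C j).path[k] (f.passTime C j k φ) := by
  rw [passTime, ← List.take_append_getElem hk, List.foldl_append]
  rfl

omit [Fintype E] in
theorem arrivalTime_eq_passTime (f : FlowRates J E) (C : J → Commodity N) (j : J) {k : ℕ}
    (hk : k < (N.pathNodes (C j).path).length) :
    f.arrivalTime N C j (N.pathNodes (C j).path)[k] = f.passTime C j k := by
  have hp := (C j).isSimplePath
  ext φ
  unfold arrivalTime passTime
  congr 1
  obtain ⟨v, hv⟩ : ∃ v, v = (N.pathNodes (C j).path)[k] := ⟨_, rfl⟩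
  rw [← hv]
  conv_lhs => rw [← List.take_append_drop k (C j).path]
  rw [List.takeWhile_append_of_pos]
  · suffices ((C j).path.drop k).takeWhile (fun e => N.src e ≠ v) = [] by
      rw [this, List.append_nil]
    rcases lt_or_ge k (C j).path.length with hlt | hge
    · rw [List.drop_eq_getElem_cons hlt, List.takeWhile_cons_of_neg]
      simp [hv, hp.pathNodes_of_lt hlt]
    · rw [List.drop_eq_nil_of_le hge]
      rfl
  · intro e he
    obtain ⟨i, hi, rfl⟩ := List.getElem_of_mem he
    rw [List.length_take] at hi
    rw [List.getElem_take, ← hp.pathNodes_of_lt (by omega), hv]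
    simp only [ne_eq, decide_not, Bool.not_eq_eq_eq_not, Bool.not_true, decide_eq_false_iff_not]
    rw [hp.simple.getElem_inj_iff]
    omega

variable (hf : f.IsFeasible N C) (hfP : f.UsesPaths C) (j : J)
include hf

theorem IsFeasible.isRate_passRate (k : ℕ) : IsRate (f.passRate C j k) := by
  unfold passRate
  split_ifs
  · exact hf.isRate_in _ _
  · exact hf.isRate_out _ _

include hfP

theorem IsFeasible.cumulative_passRate_zero :
    cumulative (f.passRate C j 0) = cumulative (C j).rate := by
  rw [cumulative_passRate_of_lt f C j (C j).isSimplePath.length_pos, hf.cumIn_zero hfP]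

theorem IsFeasible.cumulative_passRate_succ {k : ℕ} (hk : k < (C j).path.length) :
    cumulative (f.passRate C j (k + 1)) = f.cumOut j (C j).path[k] := by
  rcases Nat.lt_or_ge (k + 1) (C j).path.length with hlt | hge
  · rw [cumulative_passRate_of_lt f C j hlt, hf.cumIn_succ hfP j hlt]
  · have : k = (C j).path.length - 1 := by omega
    rw [passRate, dif_neg (by omega)]
    subst this
    rfl

/-- What has left an arc by `θ` has left it by the later exit time of `θ`, and this is what entered
by `θ`. -/
theorem IsFeasible.cumulative_passRate_le {k : ℕ} (hk : k ≤ (C j).path.length) (θ : ℝ) :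
    cumulative (f.passRate C j k) θ ≤ (C j).mass := by
  induction k with
  | zero =>
    rw [hf.cumulative_passRate_zero hfP]
    exact (C j).cumulative_rate_le_mass θ
  | succ k ih =>
    rw [hf.cumulative_passRate_succ hfP j hk]
    have h1 := ih (by omega)
    rw [cumulative_passRate_of_lt f C j hk, ← hf.cumOut_exitTime] at h1
    refine le_trans ((hf.isRate_out j _).cumulative_mono ?_) h1
    rw [hf.exitTime_eq]
    linarith [(hf.isQueueFlow (C j).path[k]).le_queueExit θ, N.tau_pos (C j).path[k]]

/-- For `φ > 0` the arrival time is the first time at which the cumulative flow through the node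
reaches `φ`. Induction along the path: an earlier time `θ` is the exit time of an entrance time
which, by monotonicity, precedes the arrival of `φ` at the previous node. -/
theorem IsFeasible.passTime_spec {k : ℕ} (hk : k ≤ (C j).path.length) {φ : ℝ}
    (hφ : φ ∈ Set.Icc 0 (C j).mass) :
    0 ≤ f.passTime C j k φ ∧ cumulative (f.passRate C j k) (f.passTime C j k φ) = φ ∧
      (0 < φ → ∀ θ < f.passTime C j k φ, cumulative (f.passRate C j k) θ < φ) := by
  induction k with
  | zero =>
    rw [hf.cumulative_passRate_zero hfP]
    have hl := (C j).isLeast_releaseTime hφ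
    refine ⟨hl.1.1, hl.1.2, fun hpos θ hθ => ?_⟩
    change θ < (C j).releaseTime φ at hθ
    rcases lt_or_ge θ 0 with h0 | h0
    · rwa [(C j).isRate_rate.cumulative_of_nonpos h0.le]
    · refine lt_of_le_of_ne (((C j).isRate_rate.cumulative_mono hθ.le).trans_eq hl.1.2) fun he => ?_
      exact absurd (hl.2 ⟨h0, he⟩) (not_le.2 hθ)
  | succ k ih =>
    obtain ⟨h1, h2, h3⟩ := ih (by omega)
    rw [hf.cumulative_passRate_succ hfP j hk, passTime_succ f C j hk]
    rw [cumulative_passRate_of_lt f C j hk] at h2 h3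
    have hq := hf.isQueueFlow (C j).path[k]
    refine ⟨?_, by rw [hf.cumOut_exitTime, h2], fun hpos θ hθ => ?_⟩
    · rw [hf.exitTime_eq]
      linarith [hq.le_queueExit (f.passTime C j k φ), N.tau_pos (C j).path[k]]
    · have h4 := hq.queueExit_queueEntrance θ
      have h5 := hq.queueExit_mono
      rw [← hf.exitTime_eq] at h4 h5
      rw [← h4, hf.cumOut_exitTime]
      refine h3 hpos _ ?_
      by_contra! hc
      have := h5 hc
      rw [h4] at this
      linarith

end FlowRates

namespace Loading

variable {J V E : Type*} (X : Loading J V E) (N : Network V E) (C : J → Commodity N) (α β : ℝ)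

/-- The number of packets of commodity `j` that pass the `k`-th node of their path in time step
`t`. -/
noncomputable def passStep (j : J) (k t : ℕ) : ℕ :=
  if hk : k < (C j).path.length then packetCount j (X.entering t (C j).path[k])
  else packetCount j (X.leaving N α t ((C j).path[(C j).path.length - 1]'
    (Nat.sub_lt (C j).isSimplePath.length_pos one_pos)))

/-- The number of packets of commodity `j` that pass the `k`-th node of their path before time step
`t`. -/
noncomputable def passCount (j : J) (k t : ℕ) : ℕ :=
  ∑ s ∈ Finset.range t, X.passStep N C α j k s

theorem passCount_of_lt (j : J) {k : ℕ} (hk : k < (C j).path.length) (t : ℕ) :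
    X.passCount N C α j k t = X.inCount j (C j).path[k] t := by
  simp only [passCount, passStep, dif_pos hk]
  rfl

theorem passCount_mono (j : J) (k : ℕ) : Monotone (X.passCount N C α j k) :=
  monotone_nat_of_le_succ fun t => by simp [passCount, Finset.sum_range_succ]

theorem cumThrough_eq [DecidableEq V] (j : J) {k : ℕ}
    (hk : k < (N.pathNodes (C j).path).length) :
    X.cumThrough N C α β j (N.pathNodes (C j).path)[k] =
      stepCumulative α β (X.passStep N C α j k) := by
  have hp := (C j).isSimplePath
  have hlen := hp.length_pathNodes
  ext θ
  unfold cumThrough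
  rcases Nat.lt_or_ge k (C j).path.length with hlt | hge
  · have : (C j).path.find? (fun e => N.src e = (N.pathNodes (C j).path)[k]) =
        some (C j).path[k] := by
      rw [List.find?_eq_some_iff_getElem]
      refine ⟨by simp [hp.pathNodes_of_lt hlt], k, hlt, rfl, fun i hi => ?_⟩
      rw [hp.pathNodes_of_lt hlt]
      simp only [Bool.not_eq_eq_eq_not, Bool.not_true, decide_eq_false_iff_not]
      intro he
      have := hp.src_injective (hi.trans hlt) hlt he
      omega
    rw [this]
    have h2 : X.passStep N C α j k = fun t => packetCount j (X.entering t (C j).path[k]) := by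
      ext t
      rw [passStep, dif_pos hlt]
    rw [h2]
    rfl
  · have hkl : k = (C j).path.length := by omega
    have : (C j).path.find? (fun e => N.src e = (N.pathNodes (C j).path)[k]) = none := by
      rw [List.find?_eq_none]
      intro e he
      obtain ⟨i, hi, rfl⟩ := List.getElem_of_mem he
      rw [← hp.pathNodes_of_lt hi]
      simp only [decide_eq_true_eq]
      rw [hp.simple.getElem_inj_iff]
      omega
    have hlast : (C j).path.getLast? = some ((C j).path[(C j).path.length - 1]'
        (Nat.sub_lt hp.length_pos one_pos)) := by
      rw [List.getLast?_eq_getElem?, List.getElem?_eq_getElem]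
    rw [this, hlast]
    have h2 : X.passStep N C α j k = fun t => packetCount j (X.leaving N α t
        ((C j).path[(C j).path.length - 1]'(Nat.sub_lt hp.length_pos one_pos))) := by
      ext t
      rw [passStep, dif_neg (by omega)]
    rw [h2]
    rfl

namespace IsNetworkLoading

variable {X N C α β} [DecidableEq E] [Fintype E] (h : X.IsNetworkLoading N C α β)
  (hα : 0 < α) (hβ : 0 < β) (j : J)
include h

theorem passCount_succ {k : ℕ} (hk : k < (C j).path.length) (t : ℕ) :
    X.passCount N C α j (k + 1) t = X.outCount N α j (C j).path[k] t := by
  rcases Nat.lt_or_ge (k + 1) (C j).path.length with hlt | hge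
  · rw [passCount_of_lt X N C α j hlt, h.inCount_succ j hlt]
  · have : k = (C j).path.length - 1 := by omega
    simp only [passCount, passStep, dif_neg (not_lt.2 hge)]
    subst this
    rfl

theorem passCount_zero (t : ℕ) : X.passCount N C α j 0 t =
    ((Finset.Icc 1 ((C j).numPackets β)).filter (fun i => (C j).releaseStep α β i < t)).card := by
  rw [passCount_of_lt X N C α j (C j).isSimplePath.length_pos, h.inCount_zero_eq_card]

include hα

theorem passCount_le {k : ℕ} (hk : k ≤ (C j).path.length) (t : ℕ) :
    X.passCount N C α j k t ≤ (C j).numPackets β := by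
  induction k with
  | zero =>
    rw [h.passCount_zero]
    exact (Finset.card_filter_le _ _).trans (by simp)
  | succ k ih =>
    have h1 := ih (by omega)
    rw [passCount_of_lt X N C α j hk] at h1
    rw [h.passCount_succ j hk]
    exact (h.outCount_le_inCount hα j _ t).trans h1

include hβ

theorem mul_passCount_le {k : ℕ} (hk : k ≤ (C j).path.length) (t : ℕ) :
    β * X.passCount N C α j k t ≤ (C j).mass := by
  have hm : 0 ≤ (C j).mass := setIntegral_nonneg measurableSet_Ici (C j).supply_nonneg
  have h1 := (Nat.le_floor_iff (div_nonneg hm hβ.le)).1 (h.passCount_le hα j hk t)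
  rwa [le_div_iff₀' hβ] at h1

/-- Nothing happens in time step `0`. -/
theorem passStep_zero {k : ℕ} (hk : k ≤ (C j).path.length) :
    X.passStep N C α j k 0 = 0 := by
  have h0 : X.passCount N C α j k 1 = 0 := by
    cases k with
    | zero =>
      rw [passCount_of_lt X N C α j (C j).isSimplePath.length_pos, h.inCount_zero_succ hα hβ j 0]
      simp [(C j).isRate_rate.cumulative_of_nonpos le_rfl]
    | succ k =>
      rw [h.passCount_succ j hk]
      have hc : 0 < delay N α (C j).path[k] :=
        Nat.ceil_pos.2 (div_pos (N.tau_pos _) hα)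
      have h1 := h.outCount_le_add hα j (C j).path[k] 0 1
      have h2 := h.numLeft_le hα (C j).path[k] 1
      rw [show 1 - delay N α (C j).path[k] = 0 by omega] at h2
      simp only [inCount, numEntered, Finset.range_zero, Finset.sum_empty] at h1 h2
      omega
  simpa [passCount] using h0

/-- Every arc eventually releases whatever has entered it, so all packets reach every node of the
path. This makes the set defining the arrival time nonempty. -/
theorem exists_le_passCount {k : ℕ} (hk : k ≤ (C j).path.length) :
    ∃ t, (C j).numPackets β ≤ X.passCount N C α j k t := by
  induction k with
  | zero =>
    refine ⟨(∑ i ∈ Finset.Icc 1 ((C j).numPackets β), (C j).releaseStep α β i) + 1, ?_⟩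
    rw [h.passCount_zero, Finset.filter_true_of_mem]
    · simp
    · intro i hi
      exact Nat.lt_succ_of_le (Finset.single_le_sum (f := fun i => (C j).releaseStep α β i)
        (fun _ _ => Nat.zero_le _) hi)
  | succ k ih =>
    obtain ⟨s, hs⟩ := ih (by omega)
    rw [passCount_of_lt X N C α j hk] at hs
    obtain ⟨t, ht⟩ := h.exists_numEntered_le_numLeft hα hβ (C j).path[k] s
    refine ⟨t, ?_⟩
    rw [h.passCount_succ j hk]
    exact hs.trans (h.inCount_le_outCount hα ht j)

theorem isLeast_arrivalTime [DecidableEq V] {k : ℕ}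
    (hk : k < (N.pathNodes (C j).path).length) {i : ℕ} (hi : i ≤ (C j).numPackets β) :
    IsLeast (X.passedTimes N C α β j (N.pathNodes (C j).path)[k] i)
      (X.arrivalTime N C α β j (N.pathNodes (C j).path)[k] i) := by
  have hk' : k ≤ (C j).path.length := by
    have := (C j).isSimplePath.length_pathNodes
    omega
  have hclosed : IsClosed (X.passedTimes N C α β j (N.pathNodes (C j).path)[k] i) := by
    unfold passedTimes
    rw [cumThrough_eq X N C α β j hk]
    exact (isClosed_le continuous_const continuous_id).inter
      (isClosed_le continuous_const (continuous_stepCumulative hα hβ _))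
  refine hclosed.isLeast_csInf ?_ ⟨0, fun θ hθ => hθ.1⟩
  obtain ⟨t, ht⟩ := h.exists_le_passCount hα hβ j hk'
  refine ⟨α * t, by positivity, ?_⟩
  rw [cumThrough_eq X N C α β j hk, stepCumulative_mul hα hβ _ (h.passStep_zero hα hβ j hk')]
  have h1 : i ≤ X.passCount N C α j k (t + 1) :=
    (hi.trans ht).trans (X.passCount_mono N C α j k (Nat.le_succ t))
  rw [mul_comm]
  exact mul_le_mul_of_nonneg_left (by exact_mod_cast h1) hβ.le

end IsNetworkLoading

end Loading

/-! ### Convergence along the paths -/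

section PassConvergence

variable {V E J : Type*} [Fintype E] [Fintype J] [DecidableEq V] [DecidableEq E]
  {N : Network V E} {C : J → Commodity N} {f : FlowRates J E}
  (hf : f.IsFeasible N C) (hfP : f.UsesPaths C)
  {α β : ℕ → ℝ} (hα : ∀ n, 0 < α n) (hβ : ∀ n, 0 < β n)
  (hα0 : Tendsto α atTop (𝓝 0)) (hβ0 : Tendsto β atTop (𝓝 0))
  {X : ℕ → Loading J V E} (hX : ∀ n, (X n).IsNetworkLoading N C (α n) (β n))
include hf hfP hα hβ hα0 hβ0 hX

theorem passConverges (j : J) {k : ℕ} (hk : k ≤ (C j).path.length) (H : ℝ) {ε : ℝ} (hε : 0 < ε) :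
    ∀ᶠ n in atTop, ∀ t : ℕ, α n * t ≤ H →
      |β n * (X n).passCount N C (α n) j k t - cumulative (f.passRate C j k) (α n * t)| ≤ ε := by
  cases k with
  | zero =>
    have h0 := (C j).isSimplePath.length_pos
    filter_upwards [inflowConverges hf hfP hα hβ hα0 hβ0 hX H j ((C j).path[0]) ε hε] with n hn t ht
    rw [Loading.passCount_of_lt _ _ _ _ j h0, FlowRates.cumulative_passRate_of_lt f C j h0]
    exact hn t ht
  | succ k =>
    filter_upwards [outflowConverges hf hfP hα hβ hα0 hβ0 hX H j (C j).path[k] hε] with n hn t ht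
    rw [(hX n).passCount_succ j hk, hf.cumulative_passRate_succ hfP j hk]
    exact hn t ht

theorem tendstoUniformlyOn_pass (j : J) {k : ℕ} (hk : k ≤ (C j).path.length) :
    TendstoUniformlyOn (fun n => stepCumulative (α n) (β n) ((X n).passStep N C (α n) j k))
      (cumulative (f.passRate C j k)) atTop (Set.Ici 0) := by
  have hm : 0 ≤ (C j).mass := setIntegral_nonneg measurableSet_Ici (C j).supply_nonneg
  exact tendstoUniformlyOn_stepCumulative hα hβ hα0 (hf.isRate_passRate j k)
    (fun n => (hX n).passStep_zero (hα n) (hβ n) j hk)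
    (fun H ε hε => passConverges hf hfP hα hβ hα0 hβ0 hX j hk H hε)
    (hf.cumulative_passRate_le hfP j hk) (hf.passTime_spec hfP j hk ⟨hm, le_rfl⟩).2.1
    (fun n t => (hX n).mul_passCount_le (hα n) (hβ n) j hk t)

/-- All packets that have entered an arc by time `ξ` have left it shortly after the exit time. -/
theorem eventually_numEntered_le_numLeft (e : E) (ξ : ℝ) {ε : ℝ} (hε : 0 < ε) :
    ∀ᶠ n in atTop, ∀ t : ℕ, f.exitTime N e ξ + ε ≤ α n * t →
      (X n).numEntered e ⌈ξ / α n⌉₊ ≤ (X n).numLeft N (α n) e t := by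
  have hq := hf.isQueueFlow e
  obtain ⟨L, hL⟩ := hq.inflow.bounded
  have hL0 : 0 ≤ L := (hq.inflow.nonneg 0).trans (hL 0)
  have hν := N.nu_pos e
  have hτ := N.tau_pos e
  rw [hf.exitTime_eq]
  set T := queueExit (N.tau e) (N.nu e) (f.totalIn e) (f.totalOut e) ξ with hT
  have hTξ : ξ + N.tau e ≤ T := hq.le_queueExit ξ
  have hTA : N.nu e * (T - (ξ + N.tau e)) =
      cumulative (f.totalIn e) ξ - cumulative (f.totalOut e) (ξ + N.tau e) := hq.nu_mul_queueExit ξ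
  -- Working for a further time `ε` at capacity yields `8 δ`. Six error terms, each at most `δ`, are
  -- charged against it: the two convergence errors, the packet size, the rounding of `ξ`, and twice
  -- `ν α`.
  set δ := N.nu e * ε / 8 with hδdef
  have hδ : 0 < δ := by positivity
  have hlim1 : Tendsto (fun n => L * α n) atTop (𝓝 0) := by simpa using hα0.const_mul L
  have hlim2 : Tendsto (fun n => N.nu e * α n) atTop (𝓝 0) := by
    simpa using hα0.const_mul (N.nu e)
  rcases lt_or_ge ξ 0 with hξ | hξ
  · refine Eventually.of_forall fun n t _ => ?_
    have : ⌈ξ / α n⌉₊ = 0 := Nat.ceil_eq_zero.2 (div_nonpos_of_nonpos_of_nonneg hξ.le (hα n).le)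
    simp [this, Loading.numEntered]
  filter_upwards [(inflowConverges hf hfP hα hβ hα0 hβ0 hX (ξ + 1)).total hf e hδ,
    totalOutflowConverges hf hfP hα hβ hα0 hβ0 hX (ξ + N.tau e + 1) e hδ,
    hβ0.eventually (gt_mem_nhds hδ), hlim1.eventually (gt_mem_nhds hδ),
    hlim2.eventually (gt_mem_nhds hδ), hα0.eventually (gt_mem_nhds one_pos),
    hα0.eventually (gt_mem_nhds hε)] with n hin hout hβδ hLδ hνδ hα1 hαε t ht
  have hαn := hα n
  have hβn := hβ n
  set s := ⌈ξ / α n⌉₊ with hs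
  have hs1 : ξ ≤ α n * s := by
    have := Nat.le_ceil (ξ / α n)
    rwa [div_le_iff₀' hαn] at this
  have hs2 : α n * s ≤ ξ + α n := by
    have := (Nat.ceil_lt_add_one (div_nonneg hξ hαn.le)).le
    have := mul_le_mul_of_nonneg_left this hαn.le
    rwa [mul_add, mul_div_cancel₀ _ hαn.ne', mul_one] at this
  set c := Loading.delay N (α n) e with hc
  have hc0 : 0 < c := Nat.ceil_pos.2 (div_pos hτ hαn)
  have hc1 : N.tau e ≤ α n * c := by
    have : N.tau e / α n ≤ c := Nat.le_ceil _
    rwa [div_le_iff₀' hαn] at this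
  have hc2 : α n * c ≤ N.tau e + α n := by
    have := (Nat.ceil_lt_add_one (div_nonneg hτ.le hαn.le)).le
    have := mul_le_mul_of_nonneg_left this hαn.le
    rwa [mul_add, mul_div_cancel₀ _ hαn.ne', mul_one] at this
  have hsc : ((s + c - 1 : ℕ) : ℝ) = s + c - 1 := by
    rw [Nat.cast_sub (by omega)]
    push_cast
    ring
  have hr1 : ξ + N.tau e ≤ α n * (s + c - 1 : ℕ) + α n := by rw [hsc]; linarith
  have hr2 : α n * (s + c - 1 : ℕ) ≤ ξ + N.tau e + α n := by rw [hsc]; linarith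
  have hrt : s + c - 1 ≤ t := by
    have : α n * (s + c - 1 : ℕ) ≤ α n * t := by linarith
    exact_mod_cast le_of_mul_le_mul_left this hαn
  -- All packets entered before step `s` belong to the buffer by step `s + c - 1`. If the buffer is
  -- emptied afterwards they have left; otherwise the arc is busy until `t`, which lies `ε` beyond
  -- the exit time, and the volume balance gives the same exact inequality.
  rcases (hX n).numLeft_ge_or hαn hβn e hrt with h1 | h1
  · rwa [← hc, show s + c - 1 + 1 - c = s by omega] at h1
  · have h2 := mul_le_mul_of_nonneg_left h1 hβn.le
    have h3 : β n * ((X n).numLeft N (α n) e (s + c - 1) +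
        N.nu e * α n / β n * (t - (s + c - 1 : ℕ)) - 1) =
        β n * (X n).numLeft N (α n) e (s + c - 1) +
          N.nu e * (α n * t - α n * (s + c - 1 : ℕ)) - β n := by
      field_simp
    rw [h3] at h2
    have h4 := (abs_le.1 (hout (s + c - 1) (by linarith))).1
    have h5 := (abs_le.1 (hin s (by linarith))).2
    have h6 := hq.inflow.cumulative_lipschitz hL hs1
    have h7 : L * (α n * s - ξ) ≤ L * α n := mul_le_mul_of_nonneg_left (by linarith) hL0
    have h8 := hq.cumulative_out_sub_le (s := α n * (s + c - 1 : ℕ))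
      (t := α n * (s + c - 1 : ℕ) + α n) (by linarith)
    rw [add_sub_cancel_left] at h8
    have h9 := hq.outflow.cumulative_mono hr1
    have h10 : N.nu e * (T + ε - (ξ + N.tau e + α n)) ≤
        N.nu e * (α n * t - α n * (s + c - 1 : ℕ)) :=
      mul_le_mul_of_nonneg_left (by linarith) hν.le
    have h11 : N.nu e * (T + ε - (ξ + N.tau e + α n)) =
        N.nu e * (T - (ξ + N.tau e)) + 8 * δ - N.nu e * α n := by
      rw [hδdef]; ring
    have h12 : β n * (X n).numEntered e s ≤ β n * (X n).numLeft N (α n) e t := by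
      linarith
    exact_mod_cast le_of_mul_le_mul_left h12 hβn

/-- If `φ` is a multiple `i β` of the packet size, then the first `i` packets have passed a node
shortly after the particle `φ`. -/
theorem eventually_le_passCount (j : J) {φ : ℝ} (hφ : φ ∈ Set.Icc 0 (C j).mass) {k : ℕ}
    (hk : k ≤ (C j).path.length) {ε : ℝ} (hε : 0 < ε) :
    ∀ᶠ n in atTop, ∀ i : ℕ, i * β n = φ → ∀ t : ℕ, f.passTime C j k φ + ε ≤ α n * t →
      i ≤ (X n).passCount N C (α n) j k t := by
  induction k generalizing ε with
  | zero =>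
    filter_upwards [hα0.eventually (gt_mem_nhds hε)] with n hn i hi t ht
    have hl := (C j).isLeast_releaseTime hφ
    change (C j).releaseTime φ + ε ≤ α n * t at ht
    have hl0 := hl.1.1
    cases t with
    | zero => simp only [Nat.cast_zero, mul_zero] at ht; linarith
    | succ t =>
      rw [Loading.passCount_of_lt _ _ _ _ j (C j).isSimplePath.length_pos,
        (hX n).inCount_zero_succ (hα n) (hβ n)]
      refine Nat.le_floor ?_
      rw [le_div_iff₀ (hβ n), hi, ← hl.1.2]
      refine (C j).isRate_rate.cumulative_mono ?_
      push_cast at ht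
      linarith
  | succ k ih =>
    have hk' : k < (C j).path.length := hk
    have hcont : Continuous (f.exitTime N (C j).path[k]) := by
      rw [hf.exitTime_eq]
      exact (hf.isQueueFlow _).continuous_queueExit
    -- The delay allowed at the previous node is chosen so small that, by continuity of the exit
    -- time, it costs at most `ε / 2` here; the other half is spent on emptying the arc.
    obtain ⟨η, hη, hη'⟩ := Metric.continuous_iff.1 hcont (f.passTime C j k φ) (ε / 2) (half_pos hε)
    have hT := (abs_lt.1 (hη' (f.passTime C j k φ + η / 2)
      (by rw [Real.dist_eq, add_sub_cancel_left, abs_of_pos (half_pos hη)]; linarith))).2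
    filter_upwards [ih (by omega) (half_pos hη), eventually_numEntered_le_numLeft hf hfP hα hβ hα0
      hβ0 hX (C j).path[k] (f.passTime C j k φ + η / 2) (half_pos hε)] with n h1 h2 i hi t ht
    rw [FlowRates.passTime_succ f C j hk'] at ht
    rw [(hX n).passCount_succ j hk']
    have hs1 : f.passTime C j k φ + η / 2 ≤
        α n * ⌈(f.passTime C j k φ + η / 2) / α n⌉₊ := by
      have := Nat.le_ceil ((f.passTime C j k φ + η / 2) / α n)
      rwa [div_le_iff₀' (hα n)] at this
    have h3 := h1 i hi _ hs1
    rw [Loading.passCount_of_lt _ _ _ _ j hk'] at h3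
    exact h3.trans ((hX n).inCount_le_outCount (hα n) (h2 t (by linarith)) j)

/-- The lower bound holds at every particle, because before `φ` arrives the flow is strictly below
`φ`. The upper bound uses a later particle at points of continuity below the total mass, and the
exact count of packets otherwise. -/
theorem tendsto_arrivalTime (j : J) {k : ℕ} (hk : k < (N.pathNodes (C j).path).length) {φ : ℝ}
    (hφ : φ ∈ Set.Icc 0 (C j).mass) :
    Tendsto (fun n => (X n).arrivalTime N C (α n) (β n) j (N.pathNodes (C j).path)[k] ⌈φ / β n⌉₊)
      (atTop ⊓ 𝓟 {n | 1 ≤ ⌈φ / β n⌉₊ ∧ ⌈φ / β n⌉₊ ≤ (C j).numPackets (β n) ∧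
        (ContinuousWithinAt (f.passTime C j k) (Set.Icc 0 (C j).mass) φ ∨
          ∃ i : ℕ, φ = i * β n)})
      (𝓝 (f.passTime C j k φ)) := by
  have hk' : k ≤ (C j).path.length := by
    have := (C j).isSimplePath.length_pathNodes
    omega
  have hm : 0 ≤ (C j).mass := setIntegral_nonneg measurableSet_Ici (C j).supply_nonneg
  rcases hφ.1.eq_or_lt with h0 | hpos
  -- There is no packet `0`, so for `φ = 0` the limit is taken along the trivial filter.
  · have : ∀ n, ¬ 1 ≤ ⌈φ / β n⌉₊ := fun n => by simp [← h0]
    simp [this]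
  have hconv := fun H ε hε => eventually_abs_stepCumulative_sub_le hα hβ hα0
    (hf.isRate_passRate (C := C) j k) (x := fun n => (X n).passStep N C (α n) j k)
    (fun n => (hX n).passStep_zero (hα n) (hβ n) j hk')
    (fun H ε hε => passConverges hf hfP hα hβ hα0 hβ0 hX j hk' H hε) H (ε := ε) hε
  obtain ⟨hℓ0, hℓ, hℓmin⟩ := hf.passTime_spec hfP j hk' hφ
  have hmin := hℓmin hpos
  have hceil : ∀ n, φ ≤ ⌈φ / β n⌉₊ * β n := fun n => by
    have := Nat.le_ceil (φ / β n)
    rwa [div_le_iff₀ (hβ n)] at this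
  have hceil' : ∀ n, ⌈φ / β n⌉₊ * β n ≤ φ + β n := fun n => by
    have := (Nat.ceil_lt_add_one (div_nonneg hφ.1 (hβ n).le)).le
    have := mul_le_mul_of_nonneg_right this (hβ n).le
    rwa [add_mul, div_mul_cancel₀ _ (hβ n).ne', one_mul] at this
  rw [tendsto_order]
  constructor
  · intro a ha
    rw [eventually_inf_principal]
    obtain ⟨θ, haθ, hθ⟩ := exists_between ha
    rcases lt_or_ge θ 0 with hθ0 | hθ0
    · refine Eventually.of_forall fun n hn => ?_
      have := ((hX n).isLeast_arrivalTime (hα n) (hβ n) j hk hn.2.1).1.1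
      linarith
    have hlt := hmin θ hθ
    filter_upwards [hconv θ ((φ - cumulative (f.passRate C j k) θ) / 2) (by linarith)] with n h1 hn
    have h2 := ((hX n).isLeast_arrivalTime (hα n) (hβ n) j hk hn.2.1).1.2
    rw [Loading.cumThrough_eq _ _ _ _ _ j hk] at h2
    refine haθ.trans ?_
    by_contra! hc
    have h3 := stepCumulative_mono (hα n) (hβ n) ((X n).passStep N C (α n) j k) hc
    have h4 := (abs_le.1 (h1 θ hθ0 le_rfl)).2
    have h5 := hceil n
    linarith
  · intro b hb
    rw [eventually_inf_principal]
    set ε := (b - f.passTime C j k φ) / 2 with hε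
    have hε0 : 0 < ε := by rw [hε]; linarith
    have hmult : ∀ᶠ n in atTop, ∀ i : ℕ, i * β n = φ → i ≤ (C j).numPackets (β n) →
        (X n).arrivalTime N C (α n) (β n) j (N.pathNodes (C j).path)[k] i < b := by
      filter_upwards [eventually_le_passCount hf hfP hα hβ hα0 hβ0 hX j hφ hk' (half_pos hε0),
        hα0.eventually (gt_mem_nhds (half_pos hε0))] with n h1 h2 i hi him
      have hαn := hα n
      set s := ⌊(f.passTime C j k φ + ε) / α n⌋₊ with hs
      have hnn : 0 ≤ f.passTime C j k φ + ε := by linarith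
      have hs1 : α n * s ≤ f.passTime C j k φ + ε := by
        have := Nat.floor_le (div_nonneg hnn hαn.le)
        rwa [le_div_iff₀' hαn] at this
      have hs2 : f.passTime C j k φ + ε ≤ α n * s + α n := by
        have := (Nat.lt_floor_add_one ((f.passTime C j k φ + ε) / α n)).le
        rw [div_le_iff₀' hαn] at this
        linarith
      have h3 := (h1 i hi s (by linarith)).trans
        ((X n).passCount_mono N C (α n) j k (Nat.le_succ s))
      have h4 : (X n).arrivalTime N C (α n) (β n) j (N.pathNodes (C j).path)[k] i ≤ α n * s := by
        refine ((hX n).isLeast_arrivalTime hαn (hβ n) j hk him).2 ⟨by positivity, ?_⟩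
        rw [Loading.cumThrough_eq _ _ _ _ _ j hk, stepCumulative_mul hαn (hβ n) _
          ((hX n).passStep_zero hαn (hβ n) j hk'), mul_comm]
        exact mul_le_mul_of_nonneg_left (by exact_mod_cast h3) (hβ n).le
      linarith
    by_cases hcase : φ < (C j).mass ∧
        ContinuousWithinAt (f.passTime C j k) (Set.Icc 0 (C j).mass) φ
    · obtain ⟨hφm, hc⟩ := hcase
      obtain ⟨η, hη, hη'⟩ := Metric.continuousWithinAt_iff.1 hc ε hε0
      -- The particle `ψ > φ` arrives less than `ε` after `φ`. At its arrival the packet flow is at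
      -- least the midpoint of `φ` and `ψ`, which exceeds `φ + β` and hence the volume of the first
      -- `⌈φ / β⌉` packets.
      set ψ := min (φ + η / 2) (C j).mass with hψ
      have hφψ : φ < ψ := lt_min (by linarith) hφm
      have hψI : ψ ∈ Set.Icc 0 (C j).mass := ⟨hφ.1.trans hφψ.le, min_le_right _ _⟩
      have hd := hη' hψI (by
        rw [Real.dist_eq, abs_of_pos (by linarith)]
        linarith [min_le_left (φ + η / 2) (C j).mass])
      have hlt := (abs_lt.1 hd).2
      obtain ⟨hψ0, hψΦ, -⟩ := hf.passTime_spec hfP j hk' hψI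
      have hgap : 0 < (ψ - φ) / 2 := by linarith
      filter_upwards [hconv (f.passTime C j k ψ) _ hgap, hβ0.eventually (gt_mem_nhds hgap)] with
        n h1 h2 hn
      have h3 := (abs_le.1 (h1 _ hψ0 le_rfl)).1
      have h4 : (X n).arrivalTime N C (α n) (β n) j (N.pathNodes (C j).path)[k] ⌈φ / β n⌉₊ ≤
          f.passTime C j k ψ := by
        refine ((hX n).isLeast_arrivalTime (hα n) (hβ n) j hk hn.2.1).2 ⟨hψ0, ?_⟩
        rw [Loading.cumThrough_eq _ _ _ _ _ j hk]
        linarith [hceil' n]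
      linarith
    · filter_upwards [hmult] with n hn hS
      refine hn _ ?_ hS.2.1
      rcases hS.2.2 with hc | ⟨i, hi⟩
      -- At the last particle continuity is one-sided and no later particle is available. But `⌈m /
      -- β⌉ ≤ ⌊m / β⌋` forces the mass `m` to be a multiple of `β`, so the exact count applies.
      · have hφm : φ = (C j).mass := by
          by_contra hne
          exact hcase ⟨lt_of_le_of_ne hφ.2 hne, hc⟩
        refine le_antisymm ?_ (hceil n)
        have := (Nat.le_floor_iff (div_nonneg hm (hβ n).le)).1 hS.2.1
        rw [le_div_iff₀ (hβ n)] at this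
        exact this.trans hφm.ge
      · rw [hi, mul_div_cancel_right₀ _ (hβ n).ne', Nat.ceil_natCast]

end PassConvergence

theorem theorem2 {V E J : Type*} [Fintype V] [Fintype E] [Fintype J]
    [DecidableEq V] [DecidableEq E]
    (N : Network V E) (C : J → Commodity N)
    (f : FlowRates J E) (hf : f.IsFeasible N C) (hfP : f.UsesPaths C)
    (α β : ℕ → ℝ) (hα : ∀ n, 0 < α n) (hβ : ∀ n, 0 < β n)
    (hα0 : Tendsto α atTop (𝓝 0)) (hβ0 : Tendsto (fun n => β n / α n) atTop (𝓝 0))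
    (X : ℕ → Loading J V E) (hX : ∀ n, (X n).IsNetworkLoading N C (α n) (β n)) :
    (∀ (j : J) (v : V), v ∈ N.pathNodes (C j).path →
      (∀ᶠ n in atTop, ∀ i : ℕ, 1 ≤ i → i ≤ (C j).numPackets (β n) →
        IsLeast ((X n).passedTimes N C (α n) (β n) j v i)
          ((X n).arrivalTime N C (α n) (β n) j v i)) ∧
      ∀ φ ∈ Set.Icc 0 (C j).mass,
        Tendsto (fun n => (X n).arrivalTime N C (α n) (β n) j v ⌈φ / β n⌉₊)
          (atTop ⊓ 𝓟 {n | 1 ≤ ⌈φ / β n⌉₊ ∧ ⌈φ / β n⌉₊ ≤ (C j).numPackets (β n) ∧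
            (ContinuousWithinAt (f.arrivalTime N C j v) (Set.Icc 0 (C j).mass) φ ∨
              ∃ k : ℕ, φ = k * β n)})
          (𝓝 (f.arrivalTime N C j v φ))) ∧
    (∀ (j : J) (e : E), e ∈ (C j).path →
      TendstoUniformlyOn (fun n => (X n).cumIn (α n) (β n) j e) (f.cumIn j e) atTop
        (Set.Ici 0) ∧
      TendstoUniformlyOn (fun n => (X n).cumOut N (α n) (β n) j e) (f.cumOut j e) atTop
        (Set.Ici 0)) := by
  have hβ0' : Tendsto β atTop (𝓝 0) := by
    have := hβ0.mul hα0
    rw [mul_zero] at this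
    exact this.congr fun n => div_mul_cancel₀ _ (hα n).ne'
  constructor
  · intro j v hv
    obtain ⟨k, hk, rfl⟩ := List.getElem_of_mem hv
    refine ⟨Eventually.of_forall fun n i _ hi =>
      (hX n).isLeast_arrivalTime (hα n) (hβ n) j hk hi, fun φ hφ => ?_⟩
    rw [FlowRates.arrivalTime_eq_passTime f C j hk]
    exact tendsto_arrivalTime hf hfP hα hβ hα0 hβ0' hX j hk hφ
  · intro j e he
    obtain ⟨k, hk, rfl⟩ := List.getElem_of_mem he
    constructor
    · have h := tendstoUniformlyOn_pass hf hfP hα hβ hα0 hβ0' hX j hk.le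
      rw [FlowRates.cumulative_passRate_of_lt f C j hk] at h
      refine h.congr (Eventually.of_forall fun n θ _ => ?_)
      have h2 : (X n).passStep N C (α n) j k =
          fun t => packetCount j ((X n).entering t (C j).path[k]) := by
        ext t
        rw [Loading.passStep, dif_pos hk]
      simp only [h2]
      rfl
    · have hm : 0 ≤ (C j).mass := setIntegral_nonneg measurableSet_Ici (C j).supply_nonneg
      have hcount := fun n => (hX n).passCount_succ (C := C) j hk
      -- The cumulative counts agree at all steps, so their increments agree.
      have hstep : ∀ n t, packetCount j ((X n).leaving N (α n) t (C j).path[k]) =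
          (X n).passStep N C (α n) j (k + 1) t := by
        intro n t
        have h1 := hcount n (t + 1)
        have h2 := hcount n t
        simp only [Loading.passCount, Loading.outCount, Finset.sum_range_succ] at h1 h2
        omega
      have h := tendstoUniformlyOn_pass hf hfP hα hβ hα0 hβ0' hX j (k := k + 1) hk
      rw [hf.cumulative_passRate_succ hfP j hk] at h
      refine h.congr (Eventually.of_forall fun n θ _ => ?_)
      have h2 : (X n).passStep N C (α n) j (k + 1) =
          fun t => packetCount j ((X n).leaving N (α n) t (C j).path[k]) := by
        ext t
        rw [hstep]
      simp only [h2]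
      rfl
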